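/- **Setting.** A dg vertex algebra over $\mathbb C$ is a cochain complex $(V=\bigoplus_{p\in\mathbb Z}V^{[p]},d_V)$ with a linear map $u\mapsto Y(u,x)=\sum_{n\in\mathbb Z}u_nx^{-n-1}$ and a vacuum $\mathbf 1\in V^{[0]}$, $d_V\mathbf 1=0$, such that: $u_nV^{[q]}\subseteq V^{[p+q-2n-2]}$ and $d_V(u_nv)=(d_Vu)_nv+(-1)^{p}u_n(d_Vv)$ for $u\in V^{[p]}$; $u_nv=0$ for $n\gg0$; $Y(\mathbf 1,x)=\mathrm{id}_V$; $Y(v,x)\mathbf 1\in V[[x]]$ with constant term $v$; and the Jacobi identity holds, i.e. for homogeneous $u,v$ of degrees $|u|,|v|$ and all $l,m,n\in\mathbb Z$, $$\sum_{i\ge0}(-1)^i\binom li\bigl(u_{m+l-i}v_{n+i}-(-1)^{l+|u||v|}v_{n+l-i}u_{m+i}\bigr)=\sum_{i\ge0}\binom mi(u_{l+i}v)_{m+n-i}.$$ A dg vertex operator algebra has in addition $\omega\in V^{[4]}$ with $d_V\omega=0$ such that the operators $L(n)=\omega_{n+1}$ satisfy the Virasoro relations $[L(m),L(n)]=(m-n)L(m+n)+\frac{m^3-m}{12}\delta_{m+n,0}\,c_V$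 for some $c_V\in\mathbb C$; $V=\bigoplus_{n\in\frac12\mathbb Z}V_n$ with $V_n=\ker(L(0)-n)$; $\dim V_n<\infty$, $V_n=0$ for $n\ll0$, $\omega\in V_2$; and $L(-1)v=v_{-2}\mathbf 1$. For $0\ne u\in V_n$ put $\mathrm{wt}\,u=n$. A differential filtered vector space $(A,F^\bullet,d)$ is a complex vector space with an increasing filtration $(F^i)_{i\in\mathbb Z}$ by subspaces, $\bigcap_iF^i=0$, $\bigcup_iF^i=A$, and a linear map $d$ with $dF^i\subseteq F^{i+1}$ and $d^2F^i\subseteq F^{i+1}$. For $a\neq0$ let $|a|=\min\{i: a\in F^i\}$. It is a differential filtered algebra for an associative product $\ast$ if $F^i\ast F^j\subseteq F^{i+j}$ and $d(a\ast b)-(da\ast b+(-1)^{|a|}a\ast db)\in F^{|a|+|b|}$ for all nonzero $a,b$. **Theorem.** Let $V$ be a dg vertex operator algebra. Define a bilinear product on $V$ by $u\ast v=\sum_{n\ge0}\binom{\mathrm{wt}\,u}{n}u_{n-1}v$ for weight-homogeneous $u$ and arbitrary $v$, let $O(V)$ be the span of all $u\circ v=\sum_{n\ge0}\binom{\mathrm{wt}\,u}{n}u_{n-2}v$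 with $u$ weight-homogeneous, and let $A(V)=V/O(V)$. Then $O(V)$ is a two-sided ideal for $\ast$, so $\ast$ induces a product on $A(V)$, and $d_V$ induces a linear map $d$ on $A(V)$. Moreover: 1. $A(V)$ is an associative algebra under $\ast$. 2. The class $[\mathbf 1]$ is its unit. 3. $(A(V),F^\bullet A(V),d,\ast)$ is a differential filtered algebra, where $F^pA(V)$, $p\in\mathbb Z$, is the image of $\bigoplus_{q\le p}V^{[q]}$. 4. $[\omega]\ast a=a\ast[\omega]$ for all $a\in A(V)$. 5. $A(V)$ has a weight filtration $(W_nA(V))_{n\in\frac12\mathbb Z}$, where $W_nA(V)$ is the image of $\bigoplus_{i\le n}V_i$. That is, the $W_nA(V)$ are increasing in $n$, with $\bigcup_nW_nA(V)=A(V)$ and $\bigcap_nW_nA(V)=0$; $d(W_nA(V))\subseteq W_nA(V)$; $W_nA(V)\ast W_mA(V)\subseteq W_{n+m}A(V)$; and for each $n$ the subspaces $W_nA(V)\cap F^iA(V)$, $i\in\mathbb Z$, together with $d$, make $W_nA(V)$ a differential filtered vector space. -/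

import Mathlib

/-! Differential graded vertex operator algebras over `ℂ`, their Zhu algebras, and
differential filtered algebras. -/

open scoped VertexOperator

noncomputable section

/-- A differential graded vertex algebra over `ℂ` with underlying vector space `V`.
`Y u` is the field `Y(u, x) = ∑ₙ uₙ x^{-n-1}`; the mode `uₙ` is `(Y u)[[n]]`.  The truncation property
(`Y(u, x)v` is a Laurent series in `x` with finitely many polar terms) is built into Mathlib's type
`VertexOperator ℂ V`. -/
structure DGVertexAlgebra (V : Type*) [AddCommGroup V] [Module ℂ V] where
  /-- The component `V^[p]` of cohomological degree `p`. -/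
  deg : ℤ → Submodule ℂ V
  deg_isInternal : DirectSum.IsInternal deg
  /-- The differential. -/
  d : V →ₗ[ℂ] V
  d_mem : ∀ (p : ℤ) (v : V), v ∈ deg p → d v ∈ deg (p + 1)
  d_d : ∀ v : V, d (d v) = 0
  /-- The vertex operator map. -/
  Y : V →ₗ[ℂ] VertexOperator ℂ V
  /-- The vacuum vector. -/
  vac : V
  vac_mem : vac ∈ deg 0
  d_vac : d vac = 0
  /-- `Y` has degree zero, where `x` has degree `-2`. -/
  mode_mem : ∀ (p q n : ℤ) (u v : V), u ∈ deg p → v ∈ deg q →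
    ((Y u)[[n]]) v ∈ deg (p + q - 2 * n - 2)
  /-- `Y` commutes with the differentials. -/
  d_mode : ∀ (p n : ℤ) (u v : V), u ∈ deg p →
    d (((Y u)[[n]]) v) = ((Y (d u))[[n]]) v + p.negOnePow • ((Y u)[[n]]) (d v)
  /-- Vacuum property. -/
  vac_mode : ∀ (n : ℤ) (v : V), ((Y vac)[[n]]) v = if n = -1 then v else 0
  /-- Creation property: `Y(v, x)𝟏` has no polar terms ... -/
  mode_vac : ∀ (n : ℤ) (v : V), 0 ≤ n → ((Y v)[[n]]) vac = 0
  /-- ... and its constant term is `v`. -/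
  mode_neg_one_vac : ∀ v : V, ((Y v)[[-1]]) vac = v
  /-- The Jacobi identity: the coefficient of `x₀^{-l-1} x₁^{-m-1} x₂^{-n-1}`, applied to `w`.
  All sums are finite by truncation. -/
  jacobi : ∀ (p q l m n : ℤ) (u v w : V), u ∈ deg p → v ∈ deg q →
    (∑ᶠ i : ℕ, ((-1 : ℤ) ^ i * Ring.choose l i) •
      (((Y u)[[m + l - i]]) (((Y v)[[n + i]]) w)
        - (l + p * q).negOnePow • ((Y v)[[n + l - i]]) (((Y u)[[m + i]]) w)))
    = ∑ᶠ i : ℕ, Ring.choose m i • ((Y (((Y u)[[l + i]]) v))[[m + n - i]]) w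

/-- A differential graded vertex operator algebra.  Weights lie in `½ℤ`; throughout, the weight `k / 2`
is indexed by the integer `k`. -/
structure DGVertexOperatorAlgebra (V : Type*) [AddCommGroup V] [Module ℂ V]
    extends DGVertexAlgebra V where
  /-- The conformal vector; its mode `ω_{n+1}` is the Virasoro operator `L(n)`. -/
  ω : V
  ω_mem : ω ∈ deg 4
  d_ω : d ω = 0
  /-- The central charge. -/
  c : ℂ
  virasoro : ∀ m n : ℤ,
    ((Y ω)[[m + 1]]) * ((Y ω)[[n + 1]]) - ((Y ω)[[n + 1]]) * ((Y ω)[[m + 1]])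
      = ((m : ℂ) - n) • ((Y ω)[[m + n + 1]])
        + (if m + n = 0 then ((m : ℂ) ^ 3 - m) / 12 * c else 0) • (1 : Module.End ℂ V)
  /-- `L(0)` is diagonalizable with eigenvalues in `½ℤ`. -/
  weight_isInternal :
    DirectSum.IsInternal fun k : ℤ => Module.End.eigenspace ((Y ω)[[1]]) ((k : ℂ) / 2)
  /-- `ω` has weight `2`. -/
  ω_weight : ((Y ω)[[1]]) ω = (2 : ℂ) • ω
  weight_finite : ∀ k : ℤ,
    FiniteDimensional ℂ (Module.End.eigenspace ((Y ω)[[1]]) ((k : ℂ) / 2))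
  weight_bddBelow : ∃ N : ℤ, ∀ k < N, Module.End.eigenspace ((Y ω)[[1]]) ((k : ℂ) / 2) = ⊥
  /-- `L(-1)` is the translation operator `v ↦ v₋₂𝟏`. -/
  L_neg_one : ∀ v : V, ((Y ω)[[0]]) v = ((Y v)[[-2]]) vac

namespace DGVertexAlgebra

variable {V : Type*} [AddCommGroup V] [Module ℂ V] (S : DGVertexAlgebra V)

theorem finite_support_mode (a : ℕ → ℂ) (r : ℤ) (u v : V) :
    (Function.support fun n : ℕ => a n • ((S.Y u)[[(n : ℤ) + r]]) v).Finite := by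
  refine (Set.finite_Iio
    (-r - HahnSeries.order ((HahnModule.of ℂ).symm (S.Y u v))).toNat).subset fun n hn => ?_
  by_contra h
  apply hn
  have h0 : ((S.Y u)[[(n : ℤ) + r]]) v = 0 :=
    VertexOperator.ncoeff_eq_zero_of_lt_order _ _ _ (by
      simp only [Set.mem_Iio, not_lt] at h
      omega)
  simp [h0]

/-- The finite sum `Res_x Y(u, x) (1 + x)^s x^r v = ∑_{n ≥ 0} binom(s, n) u_{n + r} v`, bilinear in
`u` and `v`. -/
def residue (s : ℂ) (r : ℤ) : V →ₗ[ℂ] V →ₗ[ℂ] V :=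
  LinearMap.mk₂ ℂ (fun u v => ∑ᶠ n : ℕ, Ring.choose s n • ((S.Y u)[[(n : ℤ) + r]]) v)
    (fun u u' v => by
      rw [← finsum_add_distrib (S.finite_support_mode _ r u v) (S.finite_support_mode _ r u' v)]
      simp [smul_add])
    (fun a u v => by
      rw [smul_finsum' a (S.finite_support_mode _ r u v)]
      simp [smul_comm a])
    (fun u v v' => by
      rw [← finsum_add_distrib (S.finite_support_mode _ r u v) (S.finite_support_mode _ r u v')]
      simp [smul_add])
    (fun a u v => by
      rw [smul_finsum' a (S.finite_support_mode _ r u v)]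
      simp [smul_comm a])

theorem residue_apply (s : ℂ) (r : ℤ) (u v : V) :
    S.residue s r u v = ∑ᶠ n : ℕ, Ring.choose s n • ((S.Y u)[[(n : ℤ) + r]]) v := rfl

end DGVertexAlgebra

namespace DGVertexOperatorAlgebra

variable {V : Type*} [AddCommGroup V] [Module ℂ V] (S : DGVertexOperatorAlgebra V)

/-- The subspace of vectors of weight `k / 2`. -/
def weight (k : ℤ) : Submodule ℂ V :=
  Module.End.eigenspace ((S.Y S.ω)[[1]]) ((k : ℂ) / 2)

theorem bijective_coeLinearMap_weight :
    Function.Bijective (DirectSum.coeLinearMap S.weight) := S.weight_isInternal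

/-- The product `u ∗ v`, the bilinear extension of
`u ∗ v = ∑_{n ≥ 0} binom(wt u, n) u_{n-1} v` for `u` homogeneous of weight `wt u`. -/
def star : V →ₗ[ℂ] V →ₗ[ℂ] V :=
  (DirectSum.toModule ℂ ℤ (V →ₗ[ℂ] V)
      fun k => (S.residue ((k : ℂ) / 2) (-1)).comp (S.weight k).subtype).comp
    (LinearEquiv.ofBijective (DirectSum.coeLinearMap S.weight)
      S.bijective_coeLinearMap_weight).symm.toLinearMap

theorem star_of_mem_weight {k : ℤ} {u : V} (hu : u ∈ S.weight k) (v : V) :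
    S.star u v = ∑ᶠ n : ℕ, Ring.choose ((k : ℂ) / 2) n • ((S.Y u)[[(n : ℤ) - 1]]) v := by
  have h : (LinearEquiv.ofBijective (DirectSum.coeLinearMap S.weight)
      S.bijective_coeLinearMap_weight).symm u = DirectSum.lof ℂ ℤ (fun k => S.weight k) k ⟨u, hu⟩ := by
    rw [LinearEquiv.symm_apply_eq]
    exact (DirectSum.coeLinearMap_lof S.weight k ⟨u, hu⟩).symm
  simp only [star, LinearMap.comp_apply, LinearEquiv.coe_coe, h, DirectSum.toModule_lof,
    Submodule.subtype_apply, DGVertexAlgebra.residue_apply, sub_eq_add_neg]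

/-- The subspace `O(V)`, spanned by the elements
`u ∘ v = ∑_{n ≥ 0} binom(wt u, n) u_{n-2} v` with `u` homogeneous of weight `wt u`. -/
def zhuO : Submodule ℂ V :=
  Submodule.span ℂ {x | ∃ (k : ℤ) (u v : V), u ∈ S.weight k ∧
    x = ∑ᶠ n : ℕ, Ring.choose ((k : ℂ) / 2) n • ((S.Y u)[[(n : ℤ) - 2]]) v}

/-- The Zhu algebra `A(V) = V / O(V)`, as a vector space. -/
abbrev Zhu : Type _ := V ⧸ S.zhuO

/-- The class `[v]` of `v` in `A(V)`. -/
abbrev cls : V →ₗ[ℂ] S.Zhu := S.zhuO.mkQ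

/-- `F^p A(V)`, the image of `⨁_{q ≤ p} V^[q]`. -/
def zhuF (p : ℤ) : Submodule ℂ S.Zhu :=
  (⨆ q : ℤ, ⨆ _ : q ≤ p, S.deg q).map S.cls

/-- `W_{k/2} A(V)`, the image of the sum of the spaces of vectors of weight at most `k / 2`. -/
def zhuW (k : ℤ) : Submodule ℂ S.Zhu :=
  (⨆ j : ℤ, ⨆ _ : j ≤ k, S.weight j).map S.cls

end DGVertexOperatorAlgebra

section Filtered

variable {A : Type*} [AddCommGroup A] [Module ℂ A]

/-- `(A, F, d)` is a differential filtered vector space. -/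
structure IsDifferentialFilteredSpace (F : ℤ → Submodule ℂ A) (d : A →ₗ[ℂ] A) : Prop where
  mono : Monotone F
  separated : ∀ a : A, (∀ i, a ∈ F i) → a = 0
  exhaustive : ∀ a : A, ∃ i, a ∈ F i
  d_mem : ∀ (i : ℤ) (a : A), a ∈ F i → d a ∈ F (i + 1)
  d_d_mem : ∀ (i : ℤ) (a : A), a ∈ F i → d (d a) ∈ F (i + 1)

/-- `p` is the degree `|a| = min {i | a ∈ F i}` of `a` (which exists only for `a ≠ 0`). -/
def HasFilteredDegree (F : ℤ → Submodule ℂ A) (a : A) (p : ℤ) : Prop :=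
  IsLeast {i : ℤ | a ∈ F i} p

/-- `(A, F, d)` is a differential filtered algebra for the bilinear product `m`. -/
structure IsDifferentialFilteredAlgebra (F : ℤ → Submodule ℂ A) (d : A →ₗ[ℂ] A)
    (m : A →ₗ[ℂ] A →ₗ[ℂ] A) : Prop extends IsDifferentialFilteredSpace F d where
  assoc : ∀ a b c : A, m (m a b) c = m a (m b c)
  mul_mem : ∀ (i j : ℤ) (a b : A), a ∈ F i → b ∈ F j → m a b ∈ F (i + j)
  leibniz : ∀ (p q : ℤ) (a b : A), HasFilteredDegree F a p → HasFilteredDegree F b q →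
    d (m a b) - (m (d a) b + p.negOnePow • m a (d b)) ∈ F (p + q)

/-- `W` is a weight filtration on `(A, F, d, m)`, where `W k` is the part of weight at most `k / 2`.
The filtration induced by `F` on each `W k` makes it a differential filtered vector space. -/
structure IsWeightFiltration (F W : ℤ → Submodule ℂ A) (d : A →ₗ[ℂ] A)
    (m : A →ₗ[ℂ] A →ₗ[ℂ] A) : Prop where
  mono : Monotone W
  separated : ∀ a : A, (∀ k, a ∈ W k) → a = 0
  exhaustive : ∀ a : A, ∃ k, a ∈ W k
  d_mem : ∀ (k : ℤ) (a : A), a ∈ W k → d a ∈ W k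
  mul_mem : ∀ (j k : ℤ) (a b : A), a ∈ W j → b ∈ W k → m a b ∈ W (j + k)
  induced : ∀ k : ℤ, IsDifferentialFilteredSpace
    (fun i => (F i).comap (W k).subtype) (d.restrict (d_mem k))

end Filtered

end

open scoped VertexOperator

noncomputable section

/-! Write `residue s r u v` for Res_x (1+x)^s x^r Y(u,x)v. For u of weight wt u, the product u∗v is
the residue with (s,r) = (wt u, -1), and O(V) is spanned by those with (wt u, -2). The proof is
Zhu's residue calculus with Koszul signs.

One identity drives it. `jacobi_residue` multiplies the Jacobi identity by (1+x₁)^s (1+x₂)^t x₀^l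
x₁^m x₂^n and takes residues. Its cases m = 0 and l = 0 are an associativity and a commutator
formula. Since u_n v has weight wt u + wt v - n - 1, a suitable choice of s and t turns the iterates
in these formulas into residues whose exponents are governed by the weight of u_n v. The remaining
input is that every residue with exponents (wt u + m, -2-n), m ≤ n, lies in O(V)
(`residue_add_sub_mem_zhuO`), which comes from integration by parts against L(-1). Modulo O(V), this
gives the ideal property, associativity, and a commutator formula whose right side for ω is v∘𝟏.

Compatibility of the filtrations with ∗ and d is read off from the degrees and weights of modes. The
exception is separatedness of F. There the grading by degree minus twice the weight is decisive: all
modes are additive for it, so O(V) is graded, and within one graded piece low degree forces low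
weight, hence zero. -/

theorem finsum_eq_sum_range {M : Type*} [AddCommMonoid M] (f : ℕ → M) (K : ℕ)
    (h : ∀ i, K ≤ i → f i = 0) : ∑ᶠ i, f i = ∑ i ∈ Finset.range K, f i := by
  refine finsum_eq_sum_of_support_subset _ fun i hi => ?_
  rw [Finset.coe_range, Set.mem_Iio]
  by_contra hK
  exact hi (h i (not_lt.1 hK))

/-! ### Binomial identities behind the substitution x₁ = x₂ + x₀. -/

section Binomial

open Finset

theorem sum_range_prod_eq_sum_antidiagonal {M : Type*} [AddCommMonoid M] (K : ℕ)
    (g : ℕ → ℕ → M) (hg : ∀ a b, K ≤ a + b → g a b = 0) :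
    ∑ a ∈ range K, ∑ b ∈ range K, g a b
      = ∑ n ∈ range K, ∑ x ∈ antidiagonal n, g x.1 x.2 := by
  simp_rw [Nat.sum_antidiagonal_eq_sum_range_succ g]
  rw [Finset.sum_range_diag_flip]
  refine sum_congr rfl fun a _ => (sum_subset (range_mono (Nat.sub_le K a)) fun b _ hb => ?_).symm
  exact hg a b (by simp only [mem_range, not_lt] at hb; omega)

theorem intCast_choose (m : ℤ) (i : ℕ) : ((Ring.choose m i : ℤ) : ℂ) = Ring.choose (m : ℂ) i := by
  simpa using Ring.map_choose (Int.castRingHom ℂ) m i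

theorem choose_zsmul {V : Type*} [AddCommGroup V] [Module ℂ V] (m : ℤ) (i : ℕ) (x : V) :
    Ring.choose m i • x = Ring.choose (m : ℂ) i • x := by
  rw [← intCast_choose, Int.cast_smul_eq_zsmul]

/-- Both sides are the coefficient of y^P in (1+y)^t · (y^i/i!) (d/dy)^i (1+y)^s = binom(s,i) y^i
(1+y)^(s+t-i). Formally: absorb binom(a,i) into binom(s,a), then apply Vandermonde. -/
theorem sum_choose_mul_choose_mul_choose (s t : ℂ) (i P : ℕ) :
    ∑ x ∈ antidiagonal P, Ring.choose s x.1 * Ring.choose t x.2 * (x.1.choose i : ℂ)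
      = Ring.choose s i * if i ≤ P then Ring.choose (s + t - i) (P - i) else 0 := by
  split_ifs with h
  · obtain ⟨Q, rfl⟩ := Nat.exists_eq_add_of_le h
    rw [Nat.add_sub_cancel_left, show s + t - i = (s - i) + t by ring,
      Ring.add_choose_eq _ (Commute.all _ _), mul_sum]
    symm
    have h1 : ∀ x ∈ antidiagonal Q,
        Ring.choose s i * (Ring.choose (s - i) x.1 * Ring.choose t x.2)
          = Ring.choose s (i + x.1) * Ring.choose t x.2 * ((i + x.1).choose i : ℂ) := by
      intro x _
      have := Ring.choose_smul_choose s (Nat.le_add_right i x.1)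
      rw [nsmul_eq_mul, Nat.add_sub_cancel_left] at this
      linear_combination (-Ring.choose t x.2) * this
    rw [sum_congr rfl h1]
    refine sum_bij_ne_zero (fun x _ _ => (i + x.1, x.2)) ?_ ?_ ?_ ?_
    · intro x hx _
      simp only [HasAntidiagonal.mem_antidiagonal] at hx ⊢
      omega
    · rintro ⟨a, b⟩ _ _ ⟨a', b'⟩ _ _ hh
      simp only [Prod.mk.injEq] at hh ⊢
      omega
    · rintro ⟨a, b⟩ hx hne
      have hia : i ≤ a := by
        by_contra hlt
        exact hne (by simp [Nat.choose_eq_zero_of_lt (not_le.1 hlt)])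
      simp only [HasAntidiagonal.mem_antidiagonal] at hx
      refine ⟨(a - i, b), by simp only [HasAntidiagonal.mem_antidiagonal]; omega, ?_, ?_⟩
      · simpa [Nat.add_sub_cancel' hia] using hne
      · simp [Nat.add_sub_cancel' hia]
    · intro x _ _
      rfl
  · rw [mul_zero]
    refine sum_eq_zero fun x hx => ?_
    simp only [HasAntidiagonal.mem_antidiagonal] at hx
    rw [Nat.choose_eq_zero_of_lt (by omega), Nat.cast_zero, mul_zero]

theorem sum_choose_mul_choose_mul_choose_add (s t m : ℂ) (N P : ℕ) :
    ∑ x ∈ antidiagonal P, Ring.choose s x.1 * Ring.choose t x.2 * Ring.choose (m + x.1) N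
      = ∑ y ∈ antidiagonal N, Ring.choose s y.1 * Ring.choose m y.2 *
          if y.1 ≤ P then Ring.choose (s + t - y.1) (P - y.1) else 0 := by
  have h : ∀ a : ℕ, Ring.choose (m + a) N
      = ∑ y ∈ antidiagonal N, (a.choose y.1 : ℂ) * Ring.choose m y.2 := by
    intro a
    rw [add_comm, Ring.add_choose_eq _ (Commute.all _ _)]
    simp [Ring.choose_natCast]
  simp_rw [h, mul_sum]
  rw [sum_comm]
  refine sum_congr rfl fun y _ => ?_
  rw [mul_right_comm, ← sum_choose_mul_choose_mul_choose, sum_mul]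
  exact sum_congr rfl fun x _ => by ring

/-- The change of variables `x₁ = x₂ + x₀` in `(1 + x₁)^s (1 + x₂)^t x₁^m`, coefficientwise. -/
theorem sum_choose_smul_change_variables {V : Type*} [AddCommGroup V] [Module ℂ V] (s t m : ℂ)
    (K : ℕ) (X : ℕ → ℕ → V) (hX : ∀ N P, K ≤ N ∨ K ≤ P → X N P = 0) :
    ∑ a ∈ range K, ∑ b ∈ range K, (Ring.choose s a * Ring.choose t b) •
        ∑ N ∈ range K, Ring.choose (m + a) N • X N (a + b)
      = ∑ i ∈ range K, ∑ j ∈ range K, (Ring.choose s i * Ring.choose m j) •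
          ∑ c ∈ range K, Ring.choose (s + t - i) c • X (i + j) (c + i) := by
  have hshift : ∀ (z : ℂ) (i N : ℕ), ∑ c ∈ range K, Ring.choose z c • X N (c + i)
      = ∑ P ∈ range K, (if i ≤ P then Ring.choose z (P - i) else 0) • X N P := by
    intro z i N
    refine sum_bij_ne_zero (fun c _ _ => c + i) ?_ ?_ ?_ ?_
    · intro c _ hne
      rw [mem_range]
      by_contra hlt
      exact hne (by rw [hX _ _ (Or.inr (not_lt.1 hlt)), smul_zero])
    · intro c _ _ c' _ _ hh
      exact Nat.add_right_cancel hh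
    · intro P hP hne
      have hi : i ≤ P := by
        by_contra hlt
        exact hne (by rw [if_neg hlt, zero_smul])
      rw [mem_range] at hP
      refine ⟨P - i, by rw [mem_range]; omega, ?_, Nat.sub_add_cancel hi⟩
      rwa [Nat.sub_add_cancel hi, ← if_pos (c := i ≤ P) (t := Ring.choose z (P - i)) (e := 0) hi]
    · intro c _ _
      rw [if_pos (Nat.le_add_left i c), Nat.add_sub_cancel]
  simp_rw [hshift]
  rw [sum_range_prod_eq_sum_antidiagonal K
      (fun a b => (Ring.choose s a * Ring.choose t b) •
        ∑ N ∈ range K, Ring.choose (m + a) N • X N (a + b))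
      (fun a b hab => by simp [hX _ _ (Or.inr hab)]),
    sum_range_prod_eq_sum_antidiagonal K
      (fun i j => (Ring.choose s i * Ring.choose m j) •
        ∑ P ∈ range K, (if i ≤ P then Ring.choose (s + t - i) (P - i) else 0) • X (i + j) P)
      (fun i j hij => by simp [hX _ _ (Or.inl hij)])]
  have hl : ∀ P ∈ range K, ∑ x ∈ antidiagonal P, (Ring.choose s x.1 * Ring.choose t x.2) •
        ∑ N ∈ range K, Ring.choose (m + x.1) N • X N (x.1 + x.2)
      = ∑ N ∈ range K, (∑ x ∈ antidiagonal P,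
          Ring.choose s x.1 * Ring.choose t x.2 * Ring.choose (m + x.1) N) • X N P := by
    intro P _
    simp_rw [sum_smul, smul_sum]
    rw [sum_comm]
    refine sum_congr rfl fun N _ => sum_congr rfl fun x hx => ?_
    rw [HasAntidiagonal.mem_antidiagonal.1 hx, smul_smul]
  have hr : ∀ N ∈ range K, ∑ x ∈ antidiagonal N, (Ring.choose s x.1 * Ring.choose m x.2) •
        ∑ P ∈ range K, (if x.1 ≤ P then Ring.choose (s + t - x.1) (P - x.1) else 0) •
          X (x.1 + x.2) P
      = ∑ P ∈ range K, (∑ x ∈ antidiagonal N, Ring.choose s x.1 * Ring.choose m x.2 *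
          if x.1 ≤ P then Ring.choose (s + t - x.1) (P - x.1) else 0) • X N P := by
    intro N _
    simp_rw [sum_smul, smul_sum]
    rw [sum_comm]
    refine sum_congr rfl fun P _ => sum_congr rfl fun x hx => ?_
    rw [HasAntidiagonal.mem_antidiagonal.1 hx, smul_smul]
  rw [sum_congr rfl hl, sum_congr rfl hr, sum_comm]
  simp_rw [sum_choose_mul_choose_mul_choose_add]

end Binomial

/-! ### Truncation bounds and the Jacobi identity for residues. -/

namespace DGVertexAlgebra

open Finset

variable {V : Type*} [AddCommGroup V] [Module ℂ V] (S : DGVertexAlgebra V)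

theorem exists_mode_eq_zero (u v : V) : ∃ N : ℤ, ∀ n, N ≤ n → ((S.Y u)[[n]]) v = 0 :=
  ⟨-HahnSeries.order ((HahnModule.of ℂ).symm (S.Y u v)), fun n hn =>
    VertexOperator.ncoeff_eq_zero_of_lt_order _ _ _ (by omega)⟩

/-- A uniform truncation bound for finitely many pairs of vectors. -/
theorem exists_forall_mode_eq_zero (f g : ℤ → V) (l : ℤ)
    (hfg : ∃ N : ℤ, ∀ k, N ≤ k → f k = 0 ∨ g k = 0) :
    ∃ N : ℤ, ∀ k, l ≤ k → ∀ n, N ≤ n → ((S.Y (f k))[[n]]) (g k) = 0 := by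
  obtain ⟨N, hN⟩ := hfg
  choose B hB using fun k => S.exists_mode_eq_zero (f k) (g k)
  refine ⟨∑ k ∈ Icc l N, |B k|, fun k hk n hn => ?_⟩
  by_cases h : N ≤ k
  · rcases hN k h with h | h <;> simp [h]
  · refine hB k n (((le_abs_self _).trans ?_).trans hn)
    exact single_le_sum (f := fun k => |B k|) (fun _ _ => abs_nonneg _) (by simp; omega)

theorem residue_eq_sum_range (s : ℂ) (r : ℤ) (u v : V) (K : ℕ)
    (hK : ∀ n : ℕ, K ≤ n → ((S.Y u)[[(n : ℤ) + r]]) v = 0) :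
    S.residue s r u v = ∑ n ∈ range K, Ring.choose s n • ((S.Y u)[[(n : ℤ) + r]]) v := by
  rw [residue_apply, finsum_eq_sum_range _ K fun n hn => (by rw [hK n hn, smul_zero])]

/-- The Jacobi identity with all sums truncated. -/
theorem jacobi_sum_range {p q : ℤ} {u v : V} (hu : u ∈ S.deg p) (hv : v ∈ S.deg q) (l m n : ℤ)
    (w : V) (K : ℕ)
    (h1 : ∀ i : ℕ, K ≤ i → ((S.Y u)[[m + l - i]]) (((S.Y v)[[n + i]]) w) = 0)
    (h2 : ∀ i : ℕ, K ≤ i → ((S.Y v)[[n + l - i]]) (((S.Y u)[[m + i]]) w) = 0)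
    (h3 : ∀ i : ℕ, K ≤ i → ((S.Y (((S.Y u)[[l + i]]) v))[[m + n - i]]) w = 0) :
    ∑ i ∈ range K, ((-1 : ℂ) ^ i * Ring.choose (l : ℂ) i) •
        (((S.Y u)[[m + l - i]]) (((S.Y v)[[n + i]]) w)
          - (l + p * q).negOnePow • ((S.Y v)[[n + l - i]]) (((S.Y u)[[m + i]]) w))
      = ∑ i ∈ range K, Ring.choose (m : ℂ) i • ((S.Y (((S.Y u)[[l + i]]) v))[[m + n - i]]) w := by
  have h := S.jacobi p q l m n u v w hu hv
  rw [finsum_eq_sum_range _ K fun i hi => by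
      rw [h1 i hi, h2 i hi, smul_zero, sub_zero, smul_zero],
    finsum_eq_sum_range _ K fun i hi => (by rw [h3 i hi, smul_zero])] at h
  simp_rw [choose_zsmul] at h
  rw [← h]
  refine sum_congr rfl fun i _ => ?_
  rw [← intCast_choose, ← Int.cast_smul_eq_zsmul ℂ]
  push_cast
  rfl

theorem residue_residue_eq_sum_range (s t : ℂ) (r r' : ℤ) (u v w : V) (K : ℕ)
    (hv : ∀ b : ℕ, K ≤ b → ((S.Y v)[[(b : ℤ) + r']]) w = 0)
    (hu : ∀ a b : ℕ, K ≤ a → ((S.Y u)[[(a : ℤ) + r]]) (((S.Y v)[[(b : ℤ) + r']]) w) = 0) :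
    S.residue s r u (S.residue t r' v w)
      = ∑ a ∈ range K, ∑ b ∈ range K, (Ring.choose s a * Ring.choose t b) •
          ((S.Y u)[[(a : ℤ) + r]]) (((S.Y v)[[(b : ℤ) + r']]) w) := by
  rw [S.residue_eq_sum_range t r' v w K hv, map_sum, sum_comm]
  refine sum_congr rfl fun b _ => ?_
  rw [map_smul, S.residue_eq_sum_range s r u _ K (fun a => hu a b), smul_sum]
  exact sum_congr rfl fun a _ => by rw [smul_smul, mul_comm]

/-- The Jacobi identity for residues: the residue of the Jacobi identity multiplied by
`(1 + x₁)^s (1 + x₂)^t x₀^l x₁^m x₂^n`. -/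
theorem jacobi_residue {p q : ℤ} {u v : V} (hu : u ∈ S.deg p) (hv : v ∈ S.deg q) (s t : ℂ)
    (l m n : ℤ) (w : V) : ∃ K₀ : ℕ, ∀ K : ℕ, K₀ ≤ K →
    ∑ j ∈ range K, ((-1 : ℂ) ^ j * Ring.choose (l : ℂ) j) •
        (S.residue s (m + l - j) u (S.residue t (n + j) v w)
          - (l + p * q).negOnePow • S.residue t (n + l - j) v (S.residue s (m + j) u w))
      = ∑ i ∈ range K, ∑ j ∈ range K, (Ring.choose s i * Ring.choose (m : ℂ) j) •
          S.residue (s + t - i) (m + n - j) (((S.Y u)[[l + i + j]]) v) w := by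
  obtain ⟨N1, hN1⟩ := S.exists_mode_eq_zero v w
  obtain ⟨N2, hN2⟩ := S.exists_mode_eq_zero u w
  obtain ⟨N3, hN3⟩ := S.exists_mode_eq_zero u v
  obtain ⟨N4, hN4⟩ := S.exists_forall_mode_eq_zero (fun _ => u) (fun k => ((S.Y v)[[k]]) w) n
    ⟨N1, fun k hk => Or.inr (hN1 k hk)⟩
  obtain ⟨N5, hN5⟩ := S.exists_forall_mode_eq_zero (fun _ => v) (fun k => ((S.Y u)[[k]]) w) m
    ⟨N2, fun k hk => Or.inr (hN2 k hk)⟩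
  obtain ⟨N6, hN6⟩ := S.exists_forall_mode_eq_zero (fun k => ((S.Y u)[[k]]) v) (fun _ => w) l
    ⟨N3, fun k hk => Or.inl (hN3 k hk)⟩
  have hev (N : ℤ) : ∀ᶠ B : ℕ in Filter.atTop, N ≤ B :=
    tendsto_natCast_atTop_atTop.eventually_ge_atTop N
  obtain ⟨B, b1, b2, b3, b4, b5, b6, bl, bm, bn⟩ := ((hev N1).and <| (hev N2).and <|
    (hev N3).and <| (hev N4).and <| (hev N5).and <| (hev N6).and <| (hev (-l)).and <|
    (hev (-m)).and (hev (-n))).exists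
  clear hev
  -- In the iterated terms, a nonzero inner mode forces the summation index below 2B; the fixed
  -- exponents cost at most 2B more. An outer index of at least 5B then leaves mode number at least
  -- B.
  refine ⟨5 * B, fun K hK => ?_⟩
  have e1 : ∀ j : ℕ, S.residue s (m + l - j) u (S.residue t (n + j) v w)
      = ∑ a ∈ range K, ∑ b ∈ range K, (Ring.choose s a * Ring.choose t b) •
          ((S.Y u)[[m + a + l - j]]) (((S.Y v)[[n + b + j]]) w) := by
    intro j
    rw [S.residue_residue_eq_sum_range s t _ _ u v w K]
    · refine sum_congr rfl fun a _ => sum_congr rfl fun b _ => ?_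
      rw [show (a : ℤ) + (m + l - j) = m + a + l - j by ring,
        show (b : ℤ) + (n + j) = n + b + j by ring]
    · exact fun b hb => hN1 _ (by omega)
    · intro a b ha
      by_cases hj : N1 ≤ b + (n + j)
      · rw [hN1 _ hj, map_zero]
      · exact hN4 _ (by omega) _ (by omega)
  have e2 : ∀ j : ℕ, S.residue t (n + l - j) v (S.residue s (m + j) u w)
      = ∑ a ∈ range K, ∑ b ∈ range K, (Ring.choose s a * Ring.choose t b) •
          ((S.Y v)[[n + b + l - j]]) (((S.Y u)[[m + a + j]]) w) := by
    intro j
    rw [S.residue_residue_eq_sum_range t s _ _ v u w K, sum_comm]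
    · refine sum_congr rfl fun a _ => sum_congr rfl fun b _ => ?_
      rw [show (b : ℤ) + (n + l - j) = n + b + l - j by ring,
        show (a : ℤ) + (m + j) = m + a + j by ring, mul_comm]
    · exact fun b hb => hN2 _ (by omega)
    · intro a b ha
      by_cases hj : N2 ≤ b + (m + j)
      · rw [hN2 _ hj, map_zero]
      · exact hN5 _ (by omega) _ (by omega)
  have hX : ∀ N P : ℕ, K ≤ N ∨ K ≤ P →
      ((S.Y (((S.Y u)[[l + N]]) v))[[m + n + P - N]]) w = 0 := by
    intro N P h
    by_cases hN : N3 ≤ l + N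
    · simp [hN3 _ hN]
    · exact hN6 _ (by omega) _ (by omega)
  have e3 : ∀ i j : ℕ, S.residue (s + t - i) (m + n - j) (((S.Y u)[[l + i + j]]) v) w
      = ∑ c ∈ range K, Ring.choose (s + t - i) c •
          ((S.Y (((S.Y u)[[l + (i + j : ℕ)]]) v))[[m + n + (c + i : ℕ) - (i + j : ℕ)]]) w := by
    intro i j
    have h : ∀ c : ℕ, (c : ℤ) + (m + n - j) = m + n + (c + i : ℕ) - (i + j : ℕ) := fun c => by
      push_cast; ring
    rw [S.residue_eq_sum_range _ _ _ _ K]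
    · refine sum_congr rfl fun c _ => ?_
      rw [h, Nat.cast_add i j, add_assoc]
    · intro c hc
      rw [h, add_assoc, ← Nat.cast_add]
      exact hX _ _ (Or.inr (by omega))
  simp_rw [e1, e2, e3]
  rw [← sum_choose_smul_change_variables s t m K
    (fun N P => ((S.Y (((S.Y u)[[l + (N : ℤ)]]) v))[[m + n + (P : ℤ) - N]]) w) hX]
  -- For fixed powers of x₁ and x₂ taken from the two binomial series, this is the plain Jacobi
  -- identity with m, n shifted by a, b.
  have hj : ∀ a b : ℕ, ∑ j ∈ range K, ((-1 : ℂ) ^ j * Ring.choose (l : ℂ) j) •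
        (((S.Y u)[[m + a + l - j]]) (((S.Y v)[[n + b + j]]) w)
          - (l + p * q).negOnePow • ((S.Y v)[[n + b + l - j]]) (((S.Y u)[[m + a + j]]) w))
      = ∑ N ∈ range K, Ring.choose ((m : ℂ) + a) N •
          ((S.Y (((S.Y u)[[l + (N : ℤ)]]) v))[[m + n + ((a + b : ℕ) : ℤ) - N]]) w := by
    intro a b
    rw [S.jacobi_sum_range hu hv l (m + a) (n + b) w K]
    · refine sum_congr rfl fun N _ => ?_
      rw [show m + a + (n + b) - (N : ℤ) = m + n + ((a + b : ℕ) : ℤ) - N by push_cast; ring]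
      push_cast
      rfl
    · exact fun i hi => by rw [hN1 _ (by omega), map_zero]
    · exact fun i hi => by rw [hN2 _ (by omega), map_zero]
    · exact fun i hi => by simp [hN3 (l + i) (by omega)]
  simp_rw [← hj, smul_sum, ← sum_sub_distrib, smul_sum]
  rw [sum_comm]
  refine sum_congr rfl fun a _ => ?_
  rw [sum_comm]
  refine sum_congr rfl fun b _ => sum_congr rfl fun j _ => ?_
  simp only [smul_sub, smul_comm (Ring.choose s a * Ring.choose t b)]

end DGVertexAlgebra

/-! ### Translation, commutators and integration by parts. -/

namespace DGVertexAlgebra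

open Finset

variable {V : Type*} [AddCommGroup V] [Module ℂ V] (S : DGVertexAlgebra V)

theorem deg_induction {P : V → Prop} (h : ∀ p, ∀ v ∈ S.deg p, P v)
    (hadd : ∀ v w, P v → P w → P (v + w)) (v : V) : P v := by
  have hv : v ∈ ⨆ p, S.deg p := by
    rw [S.deg_isInternal.submodule_iSup_eq_top]; trivial
  exact Submodule.iSup_induction S.deg (motive := P) hv h (h 0 0 (zero_mem _)) hadd

theorem exists_residue_eq_sum_range (s : ℂ) (r : ℤ) (u v : V) : ∃ K₀ : ℕ, ∀ K, K₀ ≤ K →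
    S.residue s r u v = ∑ n ∈ range K, Ring.choose s n • ((S.Y u)[[(n : ℤ) + r]]) v := by
  obtain ⟨N, hN⟩ := S.exists_mode_eq_zero u v
  exact ⟨(N - r).toNat, fun K hK => S.residue_eq_sum_range s r u v K fun n hn => hN _ (by omega)⟩

theorem residue_mem {P : Submodule ℂ V} {s : ℂ} {r : ℤ} {u v : V}
    (h : ∀ n : ℕ, ((S.Y u)[[(n : ℤ) + r]]) v ∈ P) : S.residue s r u v ∈ P := by
  obtain ⟨K, hK⟩ := S.exists_residue_eq_sum_range s r u v
  rw [hK K le_rfl]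
  exact sum_mem fun n _ => P.smul_mem _ (h n)

/-- Multiplication by `1 + x`. -/
theorem residue_add_one (s : ℂ) (r : ℤ) (u v : V) :
    S.residue (s + 1) r u v = S.residue s r u v + S.residue s (r + 1) u v := by
  obtain ⟨K1, h1⟩ := S.exists_residue_eq_sum_range (s + 1) r u v
  obtain ⟨K2, h2⟩ := S.exists_residue_eq_sum_range s r u v
  obtain ⟨K3, h3⟩ := S.exists_residue_eq_sum_range s (r + 1) u v
  rw [h1 (K1 + K2 + K3 + 1) (by omega), h2 (K1 + K2 + K3 + 1) (by omega),
    h3 (K1 + K2 + K3) (by omega), sum_range_succ', sum_range_succ',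
    add_right_comm (∑ n ∈ range (K1 + K2 + K3), _),
    ← sum_add_distrib]
  congr 1
  · refine sum_congr rfl fun n _ => ?_
    rw [Ring.choose_succ_succ, add_smul, add_comm, Nat.cast_succ, add_right_comm, add_assoc (n : ℤ)]
  · simp

/-- This is Y(L(-1)u,x) = (d/dx) Y(u,x). In the Jacobi identity with v = 𝟏, l = -2, m = 0, the
vacuum modes leave at most one term: from the first product if n < 0, from the second if n > 0, and
none if n = 0. -/
theorem mode_vac_mode (u w : V) (n : ℤ) :
    ((S.Y (((S.Y u)[[-2]]) S.vac))[[n]]) w = -(n : ℂ) • ((S.Y u)[[n - 1]]) w := by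
  induction u using S.deg_induction with
  | hadd u u' h h' => simp only [map_add, Pi.add_apply, LinearMap.add_apply, smul_add, h, h']
  | h p u hu =>
    have h := S.jacobi p 0 (-2) 0 n u S.vac w hu S.vac_mem
    have hc : ∀ i : ℕ, (-1 : ℤ) ^ i * Ring.choose (-2 : ℤ) i = i + 1 := by
      intro i
      rw [Ring.choose_neg', Ring.multichoose_two, Units.smul_def, Int.coe_negOnePow_natCast,
        smul_eq_mul, ← mul_assoc, ← mul_pow]
      simp
    have hr : ∑ᶠ i : ℕ, Ring.choose (0 : ℤ) i •
        ((S.Y (((S.Y u)[[-2 + i]]) S.vac))[[0 + n - i]]) w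
          = ((S.Y (((S.Y u)[[-2]]) S.vac))[[n]]) w := by
      rw [finsum_eq_sum_range _ 1 (by
        intro i hi
        rw [Ring.choose_zero_pos ℤ (by omega), zero_smul])]
      simp
    rw [hr] at h
    rw [← h]
    simp only [hc, S.vac_mode]
    have hs : (-2 + p * 0 : ℤ).negOnePow = 1 := by rw [mul_zero]; exact Int.negOnePow_even _ ⟨-1, rfl⟩
    rw [hs]
    rcases lt_trichotomy n 0 with hn | rfl | hn
    · rw [finsum_eq_single _ (-n - 1).toNat]
      · have hi : (((-n - 1).toNat : ℕ) : ℤ) = -n - 1 := Int.toNat_of_nonneg (by omega)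
        rw [hi, if_pos (by ring), if_neg (by omega), ← Int.cast_smul_eq_zsmul ℂ]
        simp only [smul_zero, sub_zero, zero_add]
        rw [show (-2 - (-n - 1) : ℤ) = n - 1 by ring]
        push_cast
        ring_nf
      · intro i hi
        rw [if_neg (by omega), if_neg (by omega), map_zero, smul_zero, sub_zero, smul_zero]
    · rw [Int.cast_zero, neg_zero, zero_smul]
      refine (finsum_congr fun i => ?_).trans finsum_zero
      rw [if_neg (by omega), if_neg (by omega), map_zero, smul_zero, sub_zero, smul_zero]
    · rw [finsum_eq_single _ (n - 1).toNat]
      · have hi : (((n - 1).toNat : ℕ) : ℤ) = n - 1 := Int.toNat_of_nonneg (by omega)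
        rw [hi, if_neg (by omega), if_pos (by ring), ← Int.cast_smul_eq_zsmul ℂ, map_zero,
          zero_sub, one_smul, zero_add, sub_add_cancel, smul_neg, neg_smul]
      · intro i hi
        rw [if_neg (by omega), if_neg (by omega), map_zero, smul_zero, sub_zero, smul_zero]

theorem commutator_formula {p q : ℤ} {u v : V} (hu : u ∈ S.deg p) (hv : v ∈ S.deg q) (m : ℕ)
    (n : ℤ) (w : V) :
    ((S.Y u)[[m]]) (((S.Y v)[[n]]) w) - (p * q).negOnePow • ((S.Y v)[[n]]) (((S.Y u)[[m]]) w)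
      = ∑ i ∈ range (m + 1), m.choose i • ((S.Y (((S.Y u)[[(i : ℤ)]]) v))[[m + n - i]]) w := by
  have h := S.jacobi p q 0 m n u v w hu hv
  rw [finsum_eq_sum_range _ 1 (by
      intro i hi
      rw [Ring.choose_zero_pos ℤ (by omega), mul_zero, zero_smul]),
    finsum_eq_sum_range _ (m + 1) (by
      intro i hi
      rw [Ring.choose_natCast, Nat.choose_eq_zero_of_lt (by omega), Nat.cast_zero, zero_smul])] at h
  simpa [Ring.choose_natCast] using h

/-- Integration by parts: the residue of `Y(u, x) (1 + x)^s x^r` under the translation operator. -/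
theorem residue_mode_vac (s : ℂ) (r : ℤ) (u v : V) :
    S.residue s r (((S.Y u)[[-2]]) S.vac) v
      = -(s • S.residue (s - 1) r u v) - (r : ℂ) • S.residue s (r - 1) u v := by
  obtain ⟨K1, h1⟩ := S.exists_residue_eq_sum_range s r (((S.Y u)[[-2]]) S.vac) v
  obtain ⟨K2, h2⟩ := S.exists_residue_eq_sum_range (s - 1) r u v
  obtain ⟨K3, h3⟩ := S.exists_residue_eq_sum_range s (r - 1) u v
  rw [h1 (K1 + K2 + K3 + 1) (by omega), h2 (K1 + K2 + K3) (by omega),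
    h3 (K1 + K2 + K3 + 1) (by omega)]
  have h : ∀ n : ℕ, Ring.choose s n • ((S.Y (((S.Y u)[[-2]]) S.vac))[[(n : ℤ) + r]]) v
      = -((n * Ring.choose s n) • ((S.Y u)[[(n : ℤ) + (r - 1)]]) v)
        - (r : ℂ) • Ring.choose s n • ((S.Y u)[[(n : ℤ) + (r - 1)]]) v := by
    intro n
    rw [S.mode_vac_mode, ← add_sub_assoc, smul_smul, smul_smul, ← neg_smul, ← sub_smul]
    congr 1
    push_cast
    ring
  simp_rw [h]
  rw [sum_sub_distrib, sum_neg_distrib, ← smul_sum, sum_range_succ']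
  congr 2
  rw [Nat.cast_zero, zero_mul, zero_smul, add_zero, smul_sum]
  refine sum_congr rfl fun n _ => ?_
  have hc := Ring.choose_smul_choose s (Nat.le_add_left 1 n)
  rw [Ring.choose_one_right, Nat.choose_one_right, Nat.add_sub_cancel, Nat.cast_one,
    nsmul_eq_mul] at hc
  rw [hc, smul_smul, show ((n + 1 : ℕ) : ℤ) + (r - 1) = n + r by push_cast; ring]

end DGVertexAlgebra

/-! ### Weights of modes. -/

namespace DGVertexOperatorAlgebra

open DGVertexAlgebra

variable {V : Type*} [AddCommGroup V] [Module ℂ V] (S : DGVertexOperatorAlgebra V)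

theorem mem_weight {k : ℤ} {v : V} : v ∈ S.weight k ↔ ((S.Y S.ω)[[1]]) v = ((k : ℂ) / 2) • v :=
  Module.End.mem_eigenspace_iff

theorem ω_mem_weight : S.ω ∈ S.weight 4 := by
  rw [mem_weight, S.ω_weight]
  norm_num

theorem vac_mem_weight : S.vac ∈ S.weight 0 := by
  rw [mem_weight, S.mode_vac 1 S.ω one_pos.le]
  simp

/-- The commutator formula gives [L(0), u_n] = (L(-1)u)_{n+1} + (L(0)u)_n. No sign appears because ω
has even degree. -/
theorem mode_mem_weight {j k : ℤ} (n : ℤ) {u v : V} (hu : u ∈ S.weight j) (hv : v ∈ S.weight k) :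
    ((S.Y u)[[n]]) v ∈ S.weight (j + k - 2 * n - 2) := by
  have h : ∀ u : V, ((S.Y S.ω)[[1]]) (((S.Y u)[[n]]) v) - ((S.Y u)[[n]]) (((S.Y S.ω)[[1]]) v)
      = ((S.Y (((S.Y S.ω)[[0]]) u))[[1 + n]]) v + ((S.Y (((S.Y S.ω)[[1]]) u))[[n]]) v := by
    intro u
    induction u using S.deg_induction with
    | hadd u u' h h' =>
      simp only [map_add, Pi.add_apply, LinearMap.add_apply]
      rw [add_sub_add_comm, h, h']
      abel
    | h p u hu =>
      have := S.commutator_formula S.ω_mem hu 1 n v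
      rw [Int.negOnePow_even _ ⟨2 * p, by ring⟩] at this
      simpa [Finset.sum_range_succ] using this
  have h := h u
  rw [S.L_neg_one, S.mode_vac_mode, S.mem_weight.1 hv, S.mem_weight.1 hu, sub_eq_iff_eq_add] at h
  rw [mem_weight, h]
  simp only [map_smul, Pi.smul_apply, LinearMap.smul_apply, add_sub_cancel_left]
  rw [← add_smul, ← add_smul]
  congr 1
  push_cast
  ring

end DGVertexOperatorAlgebra

/-! ### Projections of an internal direct sum. -/

namespace DirectSum.IsInternal

variable {ι V : Type*} [DecidableEq ι] [AddCommGroup V] [Module ℂ V] {M : ι → Submodule ℂ V}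

/-- The projection onto a component of an internal direct sum, as an endomorphism. -/
def proj (hM : DirectSum.IsInternal M) (i : ι) : V →ₗ[ℂ] V :=
  ((M i).subtype.comp (DirectSum.component ℂ ι (fun i => M i) i)).comp
    (LinearEquiv.ofBijective (DirectSum.coeLinearMap M) hM).symm.toLinearMap

theorem proj_of_mem (hM : DirectSum.IsInternal M) {i : ι} {v : V} (hv : v ∈ M i) (j : ι) :
    hM.proj j v = if i = j then v else 0 := by
  have h : (LinearEquiv.ofBijective (DirectSum.coeLinearMap M) hM).symm v
      = DirectSum.lof ℂ ι (fun i => M i) i ⟨v, hv⟩ := by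
    rw [LinearEquiv.symm_apply_eq]
    exact (DirectSum.coeLinearMap_lof M i ⟨v, hv⟩).symm
  simp only [proj, LinearMap.comp_apply, LinearEquiv.coe_coe, h]
  split_ifs with hij
  · subst hij
    rw [DirectSum.component.lof_self]
    rfl
  · rw [DirectSum.component.of, dif_neg hij, map_zero]

theorem proj_mem (hM : DirectSum.IsInternal M) (i : ι) (v : V) : hM.proj i v ∈ M i :=
  Submodule.coe_mem _

theorem induction (hM : DirectSum.IsInternal M) {P : V → Prop} (h : ∀ i, ∀ v ∈ M i, P v)
    (h0 : P 0) (hadd : ∀ v w, P v → P w → P (v + w)) (v : V) : P v := by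
  have hv : v ∈ ⨆ i, M i := by
    rw [hM.submodule_iSup_eq_top]; trivial
  exact Submodule.iSup_induction M (motive := P) hv h h0 hadd

theorem exists_sum_proj (hM : DirectSum.IsInternal M) (v : V) :
    ∃ T : Finset ι, ∀ T', T ⊆ T' → ∑ i ∈ T', hM.proj i v = v := by
  induction v using hM.induction with
  | h i v hv =>
    refine ⟨{i}, fun T hT => ?_⟩
    simp_rw [hM.proj_of_mem hv]
    rw [Finset.sum_ite_eq, if_pos (hT (Finset.mem_singleton_self i))]
  | h0 => exact ⟨∅, fun T _ => by simp⟩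
  | hadd v w hv hw =>
    obtain ⟨T, hT⟩ := hv
    obtain ⟨T', hT'⟩ := hw
    refine ⟨T ∪ T', fun U hU => ?_⟩
    simp_rw [map_add]
    rw [Finset.sum_add_distrib, hT U (Finset.union_subset_left hU),
      hT' U (Finset.union_subset_right hU)]

end DirectSum.IsInternal

/-! ### Bihomogeneous reduction and residues lying in O(V). -/

namespace DGVertexOperatorAlgebra

open DGVertexAlgebra

variable {V : Type*} [AddCommGroup V] [Module ℂ V] (S : DGVertexOperatorAlgebra V)

theorem isInternal_weight : DirectSum.IsInternal S.weight := S.weight_isInternal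

/-- L(0) preserves cohomological degree, so it commutes with the degree projections and its
eigenspaces are graded. -/
theorem proj_deg_mem_weight {k : ℤ} {v : V} (hv : v ∈ S.weight k) (p : ℤ) :
    S.deg_isInternal.proj p v ∈ S.weight k := by
  have h : ∀ v : V, S.deg_isInternal.proj p (((S.Y S.ω)[[1]]) v)
      = ((S.Y S.ω)[[1]]) (S.deg_isInternal.proj p v) := by
    intro v
    induction v using S.deg_induction with
    | hadd v w h h' => simp only [map_add, h, h']
    | h q v hv =>
      have hL : ((S.Y S.ω)[[1]]) v ∈ S.deg q := by
        have := S.mode_mem 4 q 1 S.ω v S.ω_mem hv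
        rwa [show 4 + q - 2 * 1 - 2 = q by ring] at this
      rw [S.deg_isInternal.proj_of_mem hL, S.deg_isInternal.proj_of_mem hv]
      split_ifs <;> simp
  rw [mem_weight, ← h, S.mem_weight.1 hv, map_smul]

theorem weight_induction {k : ℤ} {P : V → Prop} (h : ∀ p, ∀ v ∈ S.deg p, v ∈ S.weight k → P v)
    (hadd : ∀ v w, P v → P w → P (v + w)) {v : V} (hv : v ∈ S.weight k) : P v := by
  obtain ⟨T, hT⟩ := S.deg_isInternal.exists_sum_proj v
  rw [← hT T subset_rfl]
  exact Finset.sum_induction _ P hadd (h 0 0 (zero_mem _) (zero_mem _)) fun p _ =>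
    h p _ (S.deg_isInternal.proj_mem p v) (S.proj_deg_mem_weight hv p)

theorem bidegree_induction {P : V → Prop}
    (h : ∀ p k, ∀ v ∈ S.deg p, v ∈ S.weight k → P v)
    (hadd : ∀ v w, P v → P w → P (v + w)) (v : V) : P v :=
  S.isInternal_weight.induction (fun k _ hv => S.weight_induction (fun p => h p k) hadd hv)
    (h 0 0 0 (zero_mem _) (zero_mem _)) hadd v

theorem star_eq_residue {k : ℤ} {u : V} (hu : u ∈ S.weight k) (v : V) :
    S.star u v = S.residue ((k : ℂ) / 2) (-1) u v := by
  rw [S.star_of_mem_weight hu, residue_apply]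
  rfl

theorem residue_neg_two_mem_zhuO {k : ℤ} {u : V} (hu : u ∈ S.weight k) (v : V) :
    S.residue ((k : ℂ) / 2) (-2) u v ∈ S.zhuO :=
  Submodule.subset_span ⟨k, u, v, hu, S.residue_apply _ _ _ _⟩

theorem zhuO_induction {P : V → Prop}
    (h : ∀ p j q k, ∀ u ∈ S.deg p, u ∈ S.weight j → ∀ v ∈ S.deg q, v ∈ S.weight k →
      P (S.residue ((j : ℂ) / 2) (-2) u v))
    (hadd : ∀ v w, P v → P w → P (v + w)) {x : V} (hx : x ∈ S.zhuO) : P x := by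
  have hgen : ∀ j, ∀ u ∈ S.weight j, ∀ v, P (S.residue ((j : ℂ) / 2) (-2) u v) := by
    intro j u hu v
    refine S.weight_induction (P := fun u => P (S.residue ((j : ℂ) / 2) (-2) u v)) ?_ ?_ hu
    · intro p u hu hu'
      refine S.bidegree_induction (P := fun v => P (S.residue ((j : ℂ) / 2) (-2) u v)) ?_ ?_ v
      · exact fun q k v hv hv' => h p j q k u hu hu' v hv hv'
      · exact fun v w hv hw => by rw [map_add]; exact hadd _ _ hv hw
    · exact fun v w hv hw => by rw [map_add, LinearMap.add_apply]; exact hadd _ _ hv hw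
  induction hx using Submodule.closure_induction with
  | zero => simpa using hgen 0 0 (zero_mem _) 0
  | add x y _ _ hx hy => exact hadd x y hx hy
  -- The scalar is absorbed into the second argument, so the motive only has to be additive.
  | smul_mem a x hx =>
    obtain ⟨k, u, v, hu, rfl⟩ := hx
    have := hgen k u hu (a • v)
    rwa [map_smul] at this

/-- Apply the inductive hypothesis to L(-1)u, of weight wt u + 1, and integrate by parts: the new
residue appears with the nonzero factor n + 2, and the rest is already in O(V). -/
theorem residue_sub_mem_zhuO (n : ℕ) : ∀ {k : ℤ} {u : V}, u ∈ S.weight k → ∀ v : V,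
    S.residue ((k : ℂ) / 2) (-2 - n) u v ∈ S.zhuO := by
  induction n with
  | zero => exact fun hu v => by simpa using S.residue_neg_two_mem_zhuO hu v
  | succ n ih =>
    intro k u hu v
    have hL : ((S.Y S.ω)[[0]]) u ∈ S.weight (k + 2) := by
      have := S.mode_mem_weight 0 S.ω_mem_weight hu
      rwa [show 4 + k - 2 * 0 - 2 = k + 2 by ring] at this
    have h1 := ih hL v
    rw [S.L_neg_one, S.residue_mode_vac] at h1
    have hk : (((k + 2 : ℤ) : ℂ) / 2) = (k : ℂ) / 2 + 1 := by push_cast; ring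
    rw [hk, add_sub_cancel_right, residue_add_one, sub_add_cancel] at h1
    have h2 := ih hu v
    have h3 : ((n : ℂ) + 2) • S.residue ((k : ℂ) / 2) (-2 - (n + 1 : ℕ)) u v ∈ S.zhuO := by
      convert S.zhuO.add_mem h1 (S.zhuO.smul_mem ((k : ℂ) / 2 - 1 - n) h2) using 1
      rw [show (-2 - ((n + 1 : ℕ) : ℤ)) = -2 - n - 1 by push_cast; ring]
      push_cast
      module
    exact (S.zhuO.smul_mem_iff (by norm_cast)).1 h3

/-- Expanding (1+x)^m only produces powers of x up to x^(-2-n+m), still at most x^(-2). -/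
theorem residue_add_sub_mem_zhuO {m n : ℕ} (hmn : m ≤ n) {k : ℤ} {u : V} (hu : u ∈ S.weight k)
    (v : V) : S.residue ((k : ℂ) / 2 + m) (-2 - n) u v ∈ S.zhuO := by
  induction m generalizing n with
  | zero => simpa using S.residue_sub_mem_zhuO n hu v
  | succ m ih =>
    obtain ⟨n, rfl⟩ := Nat.exists_eq_add_of_le' (Nat.one_le_of_lt hmn)
    rw [Nat.cast_succ, ← add_assoc, residue_add_one]
    refine S.zhuO.add_mem (ih (by omega)) ?_
    rw [show (-2 - ((n + 1 : ℕ) : ℤ)) + 1 = -2 - n by push_cast; ring]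
    exact ih (by omega)

/-- In x^(-1-n) (1+x)^n the top term is x^(-1); all others have exponent at most -2. -/
theorem residue_add_sub_sub_mem_zhuO (n : ℕ) {k : ℤ} {u : V} (hu : u ∈ S.weight k)
    (v : V) : S.residue ((k : ℂ) / 2 + n) (-1 - n) u v - S.residue ((k : ℂ) / 2) (-1) u v ∈ S.zhuO := by
  induction n with
  | zero => simp
  | succ n ih =>
    rw [Nat.cast_succ, ← add_assoc, residue_add_one,
      show (-1 - ((n + 1 : ℕ) : ℤ)) = -2 - n by push_cast; ring,
      show (-2 - (n : ℤ) + 1) = -1 - n by ring, add_sub_assoc]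
    exact S.zhuO.add_mem (S.residue_add_sub_mem_zhuO le_rfl hu v) ih

end DGVertexOperatorAlgebra

/-! ### Associativity and commutator formulas for residues. -/

namespace DGVertexAlgebra

open Finset

variable {V : Type*} [AddCommGroup V] [Module ℂ V] (S : DGVertexAlgebra V)

/-- The associativity formula for residues. -/
theorem associativity_residue {p q : ℤ} {u v : V} (hu : u ∈ S.deg p) (hv : v ∈ S.deg q) (s t : ℂ)
    (l n : ℤ) (w : V) : ∃ K₀ : ℕ, ∀ K : ℕ, K₀ ≤ K →
    ∑ j ∈ range K, ((-1 : ℂ) ^ j * Ring.choose (l : ℂ) j) •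
        (S.residue s (l - j) u (S.residue t (n + j) v w)
          - (l + p * q).negOnePow • S.residue t (n + l - j) v (S.residue s j u w))
      = ∑ i ∈ range K, Ring.choose s i •
          S.residue (s + t - i) n (((S.Y u)[[(i : ℤ) + l]]) v) w := by
  obtain ⟨K₀, hK⟩ := S.jacobi_residue hu hv s t l 0 n w
  refine ⟨K₀ + 1, fun K h => ?_⟩
  have := hK K (by omega)
  simp only [zero_add] at this
  rw [this]
  refine sum_congr rfl fun i _ => ?_
  obtain ⟨K, rfl⟩ := Nat.exists_eq_add_of_le' (Nat.one_le_of_lt h)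
  rw [sum_range_succ', sum_eq_zero]
  · simp [add_comm l]
  · intro j _
    rw [Int.cast_zero, Ring.choose_zero_succ, mul_zero, zero_smul]

/-- The commutator formula for residues. -/
theorem commutator_residue {p q : ℤ} {u v : V} (hu : u ∈ S.deg p) (hv : v ∈ S.deg q) (s t : ℂ)
    (m n : ℤ) (w : V) : ∃ K₀ : ℕ, ∀ K : ℕ, K₀ ≤ K →
    S.residue s m u (S.residue t n v w) - (p * q).negOnePow • S.residue t n v (S.residue s m u w)
      = ∑ i ∈ range K, ∑ j ∈ range K, (Ring.choose s i * Ring.choose (m : ℂ) j) •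
          S.residue (s + t - i) (m + n - j) (((S.Y u)[[(i : ℤ) + j]]) v) w := by
  obtain ⟨K₀, hK⟩ := S.jacobi_residue hu hv s t 0 m n w
  refine ⟨K₀ + 1, fun K h => ?_⟩
  have := hK K (by omega)
  simp only [zero_add] at this
  rw [← this]
  obtain ⟨K, rfl⟩ := Nat.exists_eq_add_of_le' (Nat.one_le_of_lt h)
  rw [sum_range_succ', sum_eq_zero]
  · simp
  · intro j _
    rw [Int.cast_zero, Ring.choose_zero_succ, mul_zero, zero_smul]

theorem residue_neg_one_vac (s : ℂ) (u : V) : S.residue s (-1) u S.vac = u := by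
  rw [S.residue_eq_sum_range s (-1) u S.vac 1 fun n hn => S.mode_vac _ _ (by omega)]
  simp [S.mode_neg_one_vac]

end DGVertexAlgebra

/-! ### Ideal property, associativity, unit and centrality of ω. -/

namespace DGVertexOperatorAlgebra

open DGVertexAlgebra Finset

variable {V : Type*} [AddCommGroup V] [Module ℂ V] (S : DGVertexOperatorAlgebra V)

theorem mode_nat_mem_weight {j k : ℤ} {u v : V} (hu : u ∈ S.weight j) (hv : v ∈ S.weight k) (a : ℕ)
    (l : ℤ) : ∃ i : ℤ, (i : ℂ) / 2 = (j : ℂ) / 2 + (k : ℂ) / 2 - a - l - 1 ∧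
      ((S.Y u)[[(a : ℤ) + l]]) v ∈ S.weight i :=
  ⟨_, by push_cast; ring, S.mode_mem_weight _ hu hv⟩

/-- The exponent t = wt v - l - 1 is chosen so that s + t - i is the weight of u_{i+l}v; the
associativity formula then assembles ∗-products on the left. -/
theorem star_residue_left {p q j k : ℤ} {u v : V} (hu : u ∈ S.deg p) (hj : u ∈ S.weight j)
    (hv : v ∈ S.deg q) (hk : v ∈ S.weight k) (l : ℤ) (w : V) : ∃ K₀ : ℕ, ∀ K : ℕ, K₀ ≤ K →
    S.star (S.residue ((j : ℂ) / 2) l u v) w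
      = ∑ i ∈ range K, ((-1 : ℂ) ^ i * Ring.choose (l : ℂ) i) •
        (S.residue ((j : ℂ) / 2) (l - i) u (S.residue ((k : ℂ) / 2 - l - 1) (-1 + i) v w)
          - (l + p * q).negOnePow • S.residue ((k : ℂ) / 2 - l - 1) (-1 + l - i) v
            (S.residue ((j : ℂ) / 2) i u w)) := by
  obtain ⟨K₁, h₁⟩ := S.exists_residue_eq_sum_range ((j : ℂ) / 2) l u v
  obtain ⟨K₂, h₂⟩ := S.associativity_residue hu hv ((j : ℂ) / 2) ((k : ℂ) / 2 - l - 1) l (-1) w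
  refine ⟨K₁ + K₂, fun K hK => ?_⟩
  rw [h₁ K (by omega), h₂ K (by omega), map_sum, LinearMap.sum_apply]
  refine sum_congr rfl fun i _ => ?_
  obtain ⟨a, ha, hmem⟩ := S.mode_nat_mem_weight hj hk i l
  rw [map_smul, LinearMap.smul_apply, S.star_eq_residue hmem, ha]
  congr 4
  ring

/-- Take l = -1 above: the i = 0 term of the first kind is u∗(v∗w), and every other term has a pole
of order at least 2 with exponent the weight of its outer vector. -/
theorem star_star_sub_mem_zhuO (u v w : V) :
    S.star (S.star u v) w - S.star u (S.star v w) ∈ S.zhuO := by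
  induction u using S.bidegree_induction with
  | hadd u u' h h' =>
    simp only [map_add, LinearMap.add_apply, add_sub_add_comm]
    exact S.zhuO.add_mem h h'
  | h p j u hu hj =>
  induction v using S.bidegree_induction with
  | hadd v v' h h' =>
    simp only [map_add, LinearMap.add_apply, add_sub_add_comm]
    exact S.zhuO.add_mem h h'
  | h q k v hv hk =>
  rw [S.star_eq_residue hj, S.star_eq_residue hj, S.star_eq_residue hk]
  obtain ⟨K, h⟩ := S.star_residue_left hu hj hv hk (-1) w
  rw [h (K + 1) (by omega), show (k : ℂ) / 2 - (-1 : ℤ) - 1 = (k : ℂ) / 2 by push_cast; ring]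
  simp_rw [smul_sub]
  rw [sum_sub_distrib, sum_range_succ', sub_sub, add_sub_assoc]
  refine S.zhuO.add_mem (sum_mem fun i _ => S.zhuO.smul_mem _ ?_) ?_
  · rw [show (-1 : ℤ) - (i + 1 : ℕ) = -2 - i by push_cast; ring]
    exact S.residue_sub_mem_zhuO i hj _
  · rw [← sub_sub, sub_right_comm]
    refine S.zhuO.sub_mem (by simp) (sum_mem fun i _ => S.zhuO.smul_mem _ ?_)
    rw [Units.smul_def]
    exact zsmul_mem (S.residue_sub_mem_zhuO i hk _) _

/-- Now l = -2. The terms led by v have exponent wt v + 1, which their pole order of at least 3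
compensates. -/
theorem star_mem_zhuO_right {x : V} (hx : x ∈ S.zhuO) (w : V) : S.star x w ∈ S.zhuO := by
  refine S.zhuO_induction (P := fun x => S.star x w ∈ S.zhuO) (fun p j q k u hu hj v hv hk => ?_)
    (fun x y h h' => by rw [map_add, LinearMap.add_apply]; exact S.zhuO.add_mem h h') hx
  obtain ⟨K, h⟩ := S.star_residue_left hu hj hv hk (-2) w
  rw [h K le_rfl]
  refine sum_mem fun i _ => S.zhuO.smul_mem _ (S.zhuO.sub_mem (S.residue_sub_mem_zhuO i hj _) ?_)
  rw [Units.smul_def]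
  refine zsmul_mem ?_ _
  have := S.residue_add_sub_mem_zhuO (Nat.le_add_left 1 i) hk (S.residue ((j : ℂ) / 2) i u w)
  rwa [show (k : ℂ) / 2 + (1 : ℕ) = (k : ℂ) / 2 - (-2 : ℤ) - 1 by push_cast; ring,
    show (-2 : ℤ) - (i + 1 : ℕ) = -1 + -2 - i by push_cast; ring] at this

/-- Commuting u∗ past v∘ leaves residues of u_{a+b}v with exponent b + 1 above its weight and pole
order b + 3, exactly within the permitted range. -/
theorem star_mem_zhuO_left (u : V) {x : V} (hx : x ∈ S.zhuO) : S.star u x ∈ S.zhuO := by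
  induction u using S.bidegree_induction with
  | hadd u u' h h' =>
    rw [map_add, LinearMap.add_apply]
    exact S.zhuO.add_mem h h'
  | h p j u hu hj =>
  refine S.zhuO_induction (P := fun x => S.star u x ∈ S.zhuO) (fun q k _ _ v hv hk w _ _ => ?_)
    (fun x y h h' => by rw [map_add]; exact S.zhuO.add_mem h h') hx
  obtain ⟨K, h⟩ := S.commutator_residue hu hv ((j : ℂ) / 2) ((k : ℂ) / 2) (-1) (-2) w
  have h := h K le_rfl
  rw [sub_eq_iff_eq_add] at h
  rw [S.star_eq_residue hj, h, Units.smul_def]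
  refine S.zhuO.add_mem (sum_mem fun a _ => sum_mem fun b _ => S.zhuO.smul_mem _ ?_)
    (zsmul_mem (S.residue_neg_two_mem_zhuO hk _) _)
  obtain ⟨i, hi, hmem⟩ := S.mode_nat_mem_weight hj hk a b
  have := S.residue_add_sub_mem_zhuO (le_refl (b + 1)) hmem w
  rw [hi] at this
  convert this using 4
  · push_cast; ring
  · push_cast; ring

/-- Apply the commutator formula to 𝟏, using that the x^(-1) residue of any vector on 𝟏 is the
vector itself. Modulo O(V) each correction term reduces to u_{a+b}v. -/
theorem star_sub_star_sub_mem_zhuO {p q j k : ℤ} {u v : V} (hu : u ∈ S.deg p) (hj : u ∈ S.weight j)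
    (hv : v ∈ S.deg q) (hk : v ∈ S.weight k) :
    S.star u v - (p * q).negOnePow • S.star v u - S.residue ((j : ℂ) / 2 - 1) 0 u v ∈ S.zhuO := by
  obtain ⟨N, hN⟩ := S.exists_mode_eq_zero u v
  obtain ⟨K₁, h₁⟩ := S.commutator_residue hu hv ((j : ℂ) / 2) ((k : ℂ) / 2) (-1) (-1) S.vac
  obtain ⟨K₂, h₂⟩ := S.exists_residue_eq_sum_range ((j : ℂ) / 2 - 1) 0 u v
  set K := K₁ + K₂ + N.toNat with hK
  have h₁ := h₁ K (by omega)
  rw [residue_neg_one_vac, residue_neg_one_vac] at h₁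
  -- Vandermonde for (1+x)^(wt u) (1+x)^(-1).
  have h₃ : S.residue ((j : ℂ) / 2 - 1) 0 u v = ∑ a ∈ range K, ∑ b ∈ range K,
      (Ring.choose ((j : ℂ) / 2) a * Ring.choose ((-1 : ℤ) : ℂ) b) •
        ((S.Y u)[[(a : ℤ) + b]]) v := by
    rw [h₂ K (by omega), sum_range_prod_eq_sum_antidiagonal K (fun a b =>
      (Ring.choose ((j : ℂ) / 2) a * Ring.choose ((-1 : ℤ) : ℂ) b) • ((S.Y u)[[(a : ℤ) + b]]) v)]
    · refine sum_congr rfl fun n _ => ?_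
      rw [sub_eq_add_neg, Ring.add_choose_eq _ (Commute.all _ _), sum_smul]
      refine sum_congr rfl fun x hx => ?_
      rw [← HasAntidiagonal.mem_antidiagonal.1 hx]
      simp
    · intro a b hab
      rw [hN _ (by omega), smul_zero]
  rw [S.star_eq_residue hj, S.star_eq_residue hk, h₁, h₃, ← sum_sub_distrib]
  simp_rw [← sum_sub_distrib, ← smul_sub]
  refine sum_mem fun a _ => sum_mem fun b _ => S.zhuO.smul_mem _ ?_
  obtain ⟨i, hi, hmem⟩ := S.mode_nat_mem_weight hj hk a b
  have := S.residue_add_sub_sub_mem_zhuO (b + 1) hmem S.vac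
  rw [residue_neg_one_vac, hi] at this
  convert this using 5
  · push_cast; ring
  · push_cast; ring

/-- For ω the commutator residue is L(-1)v + L(0)v = v₋₂𝟏 + (wt v) v₋₁𝟏, which is v∘𝟏. -/
theorem star_ω_sub_mem_zhuO (v : V) : S.star S.ω v - S.star v S.ω ∈ S.zhuO := by
  induction v using S.bidegree_induction with
  | hadd v v' h h' =>
    simp only [map_add, LinearMap.add_apply, add_sub_add_comm]
    exact S.zhuO.add_mem h h'
  | h q k v hv hk =>
  have h := S.star_sub_star_sub_mem_zhuO S.ω_mem S.ω_mem_weight hv hk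
  rw [Int.negOnePow_even _ ⟨2 * q, by ring⟩, one_smul] at h
  refine (S.zhuO.sub_mem_iff_left ?_).1 h
  have h1 : S.residue (((4 : ℤ) : ℂ) / 2 - 1) 0 S.ω v
      = ((S.Y S.ω)[[0]]) v + ((S.Y S.ω)[[1]]) v := by
    obtain ⟨K, hK⟩ := S.exists_residue_eq_sum_range (((4 : ℤ) : ℂ) / 2 - 1) 0 S.ω v
    rw [hK (K + 2) (by omega), sum_range_succ', sum_range_succ', sum_eq_zero]
    · rw [show (((4 : ℤ) : ℂ) / 2 - 1) = (1 : ℕ) by norm_num, Ring.choose_natCast,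
        Ring.choose_natCast]
      simp [add_comm]
    · intro i _
      rw [show (((4 : ℤ) : ℂ) / 2 - 1) = (1 : ℕ) by norm_num, Ring.choose_natCast,
        Nat.choose_eq_zero_of_lt (by omega), Nat.cast_zero, zero_smul]
  have h2 := S.residue_neg_two_mem_zhuO hk S.vac
  rw [S.residue_eq_sum_range _ (-2) v S.vac 2 fun n hn => S.mode_vac _ _ (by omega)] at h2
  rw [h1, S.mem_weight.1 hk, S.L_neg_one]
  simpa [sum_range_succ, S.mode_neg_one_vac] using h2

theorem vac_star (v : V) : S.star S.vac v = v := by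
  rw [S.star_eq_residue S.vac_mem_weight, S.residue_eq_sum_range _ _ _ _ 1]
  · simp [S.vac_mode]
  · intro n hn
    rw [S.vac_mode, if_neg (by omega)]

theorem star_vac (v : V) : S.star v S.vac = v := by
  induction v using S.bidegree_induction with
  | hadd v v' h h' => rw [map_add, LinearMap.add_apply, h, h']
  | h q k v hv hk => rw [S.star_eq_residue hk, residue_neg_one_vac]

end DGVertexOperatorAlgebra

/-! ### Filtrations by degree and by weight, and the differential. -/

theorem Submodule.biSup_le_induction {V : Type*} [AddCommGroup V] [Module ℂ V]
    {M : ℤ → Submodule ℂ V} {p : ℤ} {P : V → Prop} (h : ∀ q, q ≤ p → ∀ v ∈ M q, P v)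
    (h0 : P 0) (hadd : ∀ v w, P v → P w → P (v + w)) {v : V}
    (hv : v ∈ ⨆ q : ℤ, ⨆ _ : q ≤ p, M q) : P v := by
  refine Submodule.iSup_induction _ (motive := P) hv (fun q x hx => ?_) h0 hadd
  by_cases hq : q ≤ p
  · rw [iSup_pos hq] at hx
    exact h q hq x hx
  · rw [iSup_neg hq, Submodule.mem_bot] at hx
    rwa [hx]

theorem Submodule.mem_biSup_le {V : Type*} [AddCommGroup V] [Module ℂ V]
    {M : ℤ → Submodule ℂ V} {p q : ℤ} (hq : q ≤ p) {v : V} (hv : v ∈ M q) :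
    v ∈ ⨆ q : ℤ, ⨆ _ : q ≤ p, M q :=
  Submodule.mem_iSup_of_mem q (Submodule.mem_iSup_of_mem hq hv)

theorem Submodule.biSup_le_mono {V : Type*} [AddCommGroup V] [Module ℂ V]
    (M : ℤ → Submodule ℂ V) : Monotone fun p : ℤ => ⨆ q : ℤ, ⨆ _ : q ≤ p, M q :=
  fun _ _ hpp' => iSup_mono fun _ => iSup_mono' fun hq => ⟨hq.trans hpp', le_rfl⟩

theorem DirectSum.IsInternal.exists_mem_biSup_le {V : Type*} [AddCommGroup V] [Module ℂ V]
    {M : ℤ → Submodule ℂ V} (hM : DirectSum.IsInternal M) (v : V) :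
    ∃ p : ℤ, v ∈ ⨆ q : ℤ, ⨆ _ : q ≤ p, M q := by
  induction v using hM.induction with
  | h i v hv => exact ⟨i, Submodule.mem_biSup_le le_rfl hv⟩
  | h0 => exact ⟨0, zero_mem _⟩
  | hadd v w hv hw =>
    obtain ⟨p, hp⟩ := hv
    obtain ⟨q, hq⟩ := hw
    exact ⟨max p q, add_mem (Submodule.biSup_le_mono M (le_max_left p q) hp)
      (Submodule.biSup_le_mono M (le_max_right p q) hq)⟩

theorem IsDifferentialFilteredSpace.restrict {A : Type*} [AddCommGroup A] [Module ℂ A]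
    {F : ℤ → Submodule ℂ A} {d : A →ₗ[ℂ] A} (hF : IsDifferentialFilteredSpace F d)
    {W : Submodule ℂ A} (hW : ∀ a ∈ W, d a ∈ W) :
    IsDifferentialFilteredSpace (fun i => (F i).comap W.subtype) (d.restrict hW) where
  mono _ _ hij := Submodule.comap_mono (hF.mono hij)
  separated a ha := Subtype.ext (hF.separated a ha)
  exhaustive a := hF.exhaustive a
  d_mem i a ha := hF.d_mem i a ha
  d_d_mem i a ha := hF.d_d_mem i a ha

namespace DGVertexAlgebra

variable {V : Type*} [AddCommGroup V] [Module ℂ V] (S : DGVertexAlgebra V)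

theorem d_residue {p : ℤ} {u : V} (hu : u ∈ S.deg p) (s : ℂ) (r : ℤ) (v : V) :
    S.d (S.residue s r u v)
      = S.residue s r (S.d u) v + p.negOnePow • S.residue s r u (S.d v) := by
  obtain ⟨K₁, h₁⟩ := S.exists_residue_eq_sum_range s r u v
  obtain ⟨K₂, h₂⟩ := S.exists_residue_eq_sum_range s r (S.d u) v
  obtain ⟨K₃, h₃⟩ := S.exists_residue_eq_sum_range s r u (S.d v)
  rw [h₁ (K₁ + K₂ + K₃) (by omega), h₂ (K₁ + K₂ + K₃) (by omega), h₃ (K₁ + K₂ + K₃) (by omega),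
    map_sum, Finset.smul_sum, ← Finset.sum_add_distrib]
  refine Finset.sum_congr rfl fun n _ => ?_
  rw [map_smul, S.d_mode p _ u v hu, smul_add, smul_comm p.negOnePow]

end DGVertexAlgebra

namespace DGVertexOperatorAlgebra

open DGVertexAlgebra

variable {V : Type*} [AddCommGroup V] [Module ℂ V] (S : DGVertexOperatorAlgebra V)

/-- The part of `V` of cohomological degree at most `p`. -/
def degLE (p : ℤ) : Submodule ℂ V := ⨆ q : ℤ, ⨆ _ : q ≤ p, S.deg q

/-- The part of `V` of weight at most `k / 2`. -/
def weightLE (k : ℤ) : Submodule ℂ V := ⨆ j : ℤ, ⨆ _ : j ≤ k, S.weight j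

theorem proj_weight_mem_deg {p : ℤ} {v : V} (hv : v ∈ S.deg p) (k : ℤ) :
    S.isInternal_weight.proj k v ∈ S.deg p := by
  have h : ∀ v : V, S.isInternal_weight.proj k (S.deg_isInternal.proj p v)
      = S.deg_isInternal.proj p (S.isInternal_weight.proj k v) := by
    intro v
    induction v using S.bidegree_induction with
    | hadd v w h h' => simp only [map_add, h, h']
    | h q j v hv hj =>
      rw [S.deg_isInternal.proj_of_mem hv, S.isInternal_weight.proj_of_mem hj]
      split_ifs <;> simp [S.deg_isInternal.proj_of_mem hv, S.isInternal_weight.proj_of_mem hj, *]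
  have hp := h v
  rw [S.deg_isInternal.proj_of_mem hv, if_pos rfl] at hp
  rw [hp]
  exact S.deg_isInternal.proj_mem p _

theorem degLE_induction {p : ℤ} {P : V → Prop}
    (h : ∀ q, q ≤ p → ∀ k, ∀ v ∈ S.deg q, v ∈ S.weight k → P v)
    (hadd : ∀ v w, P v → P w → P (v + w)) {v : V} (hv : v ∈ S.degLE p) : P v := by
  have h0 : P 0 := h p le_rfl 0 0 (zero_mem _) (zero_mem _)
  refine Submodule.biSup_le_induction (fun q hq v hv => ?_) h0 hadd hv
  obtain ⟨T, hT⟩ := S.isInternal_weight.exists_sum_proj v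
  rw [← hT T subset_rfl]
  exact Finset.sum_induction _ P hadd h0 fun k _ =>
    h q hq k _ (S.proj_weight_mem_deg hv k) (S.isInternal_weight.proj_mem k v)

theorem star_mem_degLE {p q : ℤ} {u v : V} (hu : u ∈ S.degLE p) (hv : v ∈ S.degLE q) :
    S.star u v ∈ S.degLE (p + q) := by
  refine S.degLE_induction (P := fun u => S.star u v ∈ S.degLE (p + q)) (fun p' hp j u hu hj => ?_)
    (fun u u' h h' => by rw [map_add, LinearMap.add_apply]; exact add_mem h h') hu
  refine S.degLE_induction (P := fun v => S.star u v ∈ S.degLE (p + q)) (fun q' hq k v hv _ => ?_)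
    (fun v v' h h' => by rw [map_add]; exact add_mem h h') hv
  rw [S.star_eq_residue hj]
  exact S.residue_mem fun n => Submodule.mem_biSup_le (by omega) (S.mode_mem p' q' _ u v hu hv)

theorem star_mem_weightLE {j k : ℤ} {u v : V} (hu : u ∈ S.weightLE j) (hv : v ∈ S.weightLE k) :
    S.star u v ∈ S.weightLE (j + k) := by
  refine Submodule.biSup_le_induction (P := fun u => S.star u v ∈ S.weightLE (j + k))
    (fun j' hj u hu => ?_) (by simp)
    (fun u u' h h' => by rw [map_add, LinearMap.add_apply]; exact add_mem h h') hu
  refine Submodule.biSup_le_induction (P := fun v => S.star u v ∈ S.weightLE (j + k))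
    (fun k' hk v hv => ?_) (by simp) (fun v v' h h' => by rw [map_add]; exact add_mem h h') hv
  rw [S.star_eq_residue hu]
  exact S.residue_mem fun n => Submodule.mem_biSup_le (by omega) (S.mode_mem_weight _ hu hv)

/-- Since dω = 0 and ω has even degree, d commutes with L(0). -/
theorem d_mem_weight {k : ℤ} {v : V} (hv : v ∈ S.weight k) : S.d v ∈ S.weight k := by
  have h := S.d_mode 4 1 S.ω v S.ω_mem
  rw [S.d_ω, Int.negOnePow_even 4 ⟨2, rfl⟩, one_smul, S.mem_weight.1 hv, map_smul] at h
  rw [mem_weight, h]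
  simp

theorem d_mem_degLE {p : ℤ} {v : V} (hv : v ∈ S.degLE p) : S.d v ∈ S.degLE (p + 1) :=
  Submodule.biSup_le_induction (P := fun v => S.d v ∈ S.degLE (p + 1))
    (fun q hq v hv => Submodule.mem_biSup_le (by omega) (S.d_mem q v hv)) (by simp)
    (fun v w h h' => by rw [map_add]; exact add_mem h h') hv

theorem d_mem_weightLE {k : ℤ} {v : V} (hv : v ∈ S.weightLE k) : S.d v ∈ S.weightLE k :=
  Submodule.biSup_le_induction (P := fun v => S.d v ∈ S.weightLE k)
    (fun _ hj _ hv => Submodule.mem_biSup_le hj (S.d_mem_weight hv)) (by simp)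
    (fun v w h h' => by rw [map_add]; exact add_mem h h') hv

theorem d_star {p j : ℤ} {u : V} (hu : u ∈ S.deg p) (hj : u ∈ S.weight j) (v : V) :
    S.d (S.star u v) = S.star (S.d u) v + p.negOnePow • S.star u (S.d v) := by
  rw [S.star_eq_residue hj, S.star_eq_residue hj, S.star_eq_residue (S.d_mem_weight hj),
    S.d_residue hu]

theorem d_star_sub_mem_degLE {p q : ℤ} {u v : V} (hu : u ∈ S.degLE p) (hv : v ∈ S.degLE q) :
    S.d (S.star u v) - (S.star (S.d u) v + p.negOnePow • S.star u (S.d v)) ∈ S.degLE (p + q) := by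
  refine S.degLE_induction (P := fun u => S.d (S.star u v) -
    (S.star (S.d u) v + p.negOnePow • S.star u (S.d v)) ∈ S.degLE (p + q))
    (fun p' hp j u hu hj => ?_) (fun u u' h h' => ?_) hu
  · rw [S.d_star hu hj, add_sub_add_left_eq_sub]
    rcases hp.eq_or_lt with rfl | hp
    · simp
    -- A component of degree p' < p may carry the wrong sign, but then u∗dv has degree at most p' +
    -- q + 1 ≤ p + q. This is why Leibniz holds only modulo F^(p+q).
    · have h : S.star u (S.d v) ∈ S.degLE (p + q) :=
        Submodule.biSup_le_mono S.deg (show p' + (q + 1) ≤ p + q by omega)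
          (S.star_mem_degLE (Submodule.mem_biSup_le le_rfl hu) (S.d_mem_degLE hv))
      rw [Units.smul_def, Units.smul_def]
      exact sub_mem (zsmul_mem h _) (zsmul_mem h _)
  · simp only [map_add, LinearMap.add_apply, smul_add]
    rw [add_add_add_comm, add_sub_add_comm]
    exact add_mem h h'

theorem d_mem_zhuO {x : V} (hx : x ∈ S.zhuO) : S.d x ∈ S.zhuO := by
  refine S.zhuO_induction (P := fun x => S.d x ∈ S.zhuO) (fun p j q k u hu hj v hv hk => ?_)
    (fun x y h h' => by rw [map_add]; exact add_mem h h') hx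
  rw [S.d_residue hu, Units.smul_def]
  exact add_mem (S.residue_neg_two_mem_zhuO (S.d_mem_weight hj) v)
    (zsmul_mem (S.residue_neg_two_mem_zhuO hj _) _)

/-! ### The grading by degree minus twice the weight, and separatedness. -/

/-- The projection onto the part of `V` on which the cohomological degree minus twice the weight
is `s`. -/
def deltaProj (s : ℤ) : V →ₗ[ℂ] V :=
  (DirectSum.toModule ℂ ℤ V
      fun k => (S.deg_isInternal.proj (k + s)).comp (S.weight k).subtype).comp
    (LinearEquiv.ofBijective (DirectSum.coeLinearMap S.weight)
      S.bijective_coeLinearMap_weight).symm.toLinearMap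

theorem deltaProj_of_mem {p k : ℤ} {v : V} (hv : v ∈ S.deg p) (hk : v ∈ S.weight k) (s : ℤ) :
    S.deltaProj s v = if p - k = s then v else 0 := by
  have h : (LinearEquiv.ofBijective (DirectSum.coeLinearMap S.weight)
      S.bijective_coeLinearMap_weight).symm v
        = DirectSum.lof ℂ ℤ (fun k => S.weight k) k ⟨v, hk⟩ := by
    rw [LinearEquiv.symm_apply_eq]
    exact (DirectSum.coeLinearMap_lof S.weight k ⟨v, hk⟩).symm
  simp only [deltaProj, LinearMap.comp_apply, LinearEquiv.coe_coe, h, DirectSum.toModule_lof,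
    Submodule.subtype_apply, S.deg_isInternal.proj_of_mem hv]
  exact if_congr (by omega) rfl rfl

theorem exists_sum_deltaProj (v : V) :
    ∃ T : Finset ℤ, ∀ T', T ⊆ T' → ∑ s ∈ T', S.deltaProj s v = v := by
  induction v using S.bidegree_induction with
  | h p k v hv hk =>
    refine ⟨{p - k}, fun T hT => ?_⟩
    simp_rw [S.deltaProj_of_mem hv hk]
    rw [Finset.sum_ite_eq, if_pos (hT (Finset.mem_singleton_self _))]
  | hadd v w hv hw =>
    obtain ⟨T, hT⟩ := hv
    obtain ⟨T', hT'⟩ := hw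
    refine ⟨T ∪ T', fun U hU => ?_⟩
    simp_rw [map_add]
    rw [Finset.sum_add_distrib, hT U (Finset.union_subset_left hU),
      hT' U (Finset.union_subset_right hU)]

/-- A mode u_n shifts degree and twice the weight by the same multiple of n, so all terms of u∘v lie
in one piece of this grading. -/
theorem deltaProj_mem_zhuO (s : ℤ) {x : V} (hx : x ∈ S.zhuO) : S.deltaProj s x ∈ S.zhuO := by
  refine S.zhuO_induction (P := fun x => S.deltaProj s x ∈ S.zhuO)
    (fun p j q k u hu hj v hv hk => ?_)
    (fun x y h h' => by rw [map_add]; exact add_mem h h') hx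
  have hm (n : ℤ) := S.deltaProj_of_mem (S.mode_mem p q n u v hu hv) (S.mode_mem_weight n hj hk) s
  by_cases hs : p + q - j - k = s
  · have h : S.residue ((j : ℂ) / 2) (-2) u v ∈ LinearMap.eqLocus (S.deltaProj s) LinearMap.id :=
      S.residue_mem fun n => by
        rw [LinearMap.mem_eqLocus, hm, if_pos (by omega), LinearMap.id_apply]
    rw [LinearMap.mem_eqLocus.1 h]
    exact S.residue_neg_two_mem_zhuO hj v
  · have h : S.residue ((j : ℂ) / 2) (-2) u v ∈ LinearMap.ker (S.deltaProj s) :=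
      S.residue_mem fun n => by rw [LinearMap.mem_ker, hm, if_neg (by omega)]
    rw [LinearMap.mem_ker.1 h]
    exact zero_mem _

/-- In the piece `s`, degree q means weight (q - s)/2, and weights are bounded below. -/
theorem exists_deltaProj_eq_zero (s : ℤ) : ∃ p : ℤ, ∀ v ∈ S.degLE p, S.deltaProj s v = 0 := by
  obtain ⟨N, hN⟩ := S.weight_bddBelow
  refine ⟨s + N - 1, fun v hv => ?_⟩
  refine S.degLE_induction (P := fun v => S.deltaProj s v = 0) (fun q hq k v hv hk => ?_)
    (fun v w h h' => by rw [map_add, h, h', add_zero]) hv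
  rw [S.deltaProj_of_mem hv hk]
  split_ifs with h
  · have hk' : S.weight k = ⊥ := hN k (by omega)
    rwa [hk', Submodule.mem_bot] at hk
  · rfl

/-- For each `s`, choose a representative of degree so low that its `s`-component vanishes. As O(V)
is graded, the `s`-component of v lies in O(V); summing over `s` gives v in O(V). -/
theorem zhuF_separated (a : S.Zhu) (ha : ∀ i, a ∈ S.zhuF i) : a = 0 := by
  obtain ⟨v, rfl⟩ := S.zhuO.mkQ_surjective a
  have h : ∀ s, S.deltaProj s v ∈ S.zhuO := by
    intro s
    obtain ⟨p, hp⟩ := S.exists_deltaProj_eq_zero s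
    obtain ⟨u, hu, huv⟩ := ha p
    have := S.deltaProj_mem_zhuO s ((Submodule.Quotient.eq S.zhuO).1 huv)
    rwa [map_sub, hp u hu, zero_sub, neg_mem_iff] at this
  obtain ⟨T, hT⟩ := S.exists_sum_deltaProj v
  rw [Submodule.mkQ_apply, Submodule.Quotient.mk_eq_zero, ← hT T subset_rfl]
  exact sum_mem fun s _ => h s

theorem zhuW_separated (a : S.Zhu) (ha : ∀ k, a ∈ S.zhuW k) : a = 0 := by
  obtain ⟨N, hN⟩ := S.weight_bddBelow
  obtain ⟨v, hv, rfl⟩ := ha (N - 1)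
  have hle : S.weightLE (N - 1) ≤ ⊥ := iSup₂_le fun k hk => (hN k (by omega)).le
  have h0 : v = 0 := (Submodule.mem_bot ℂ).1 (hle hv)
  rw [h0, map_zero]

/-! ### The structures induced on A(V). -/

/-- The product induced by `∗` on the Zhu algebra. -/
def zhuMul : S.Zhu →ₗ[ℂ] S.Zhu →ₗ[ℂ] S.Zhu :=
  S.zhuO.liftQ
    { toFun := fun u => S.zhuO.mapQ S.zhuO (S.star u) fun _ hx => S.star_mem_zhuO_left u hx
      map_add' := fun u v => by ext; simp
      map_smul' := fun a u => by ext; simp }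
    fun x hx => by
      rw [LinearMap.mem_ker]
      ext w
      exact (Submodule.Quotient.mk_eq_zero S.zhuO).2 (S.star_mem_zhuO_right hx w)

/-- The differential induced on the Zhu algebra. -/
def zhuD : S.Zhu →ₗ[ℂ] S.Zhu := S.zhuO.mapQ S.zhuO S.d fun _ hx => S.d_mem_zhuO hx

theorem zhuMul_cls (u v : V) : S.zhuMul (S.cls u) (S.cls v) = S.cls (S.star u v) := rfl

theorem zhuD_cls (v : V) : S.zhuD (S.cls v) = S.cls (S.d v) := rfl

theorem cls_eq_cls {u v : V} : S.cls u = S.cls v ↔ u - v ∈ S.zhuO := Submodule.Quotient.eq S.zhuO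

theorem zhuMul_assoc (a b c : S.Zhu) :
    S.zhuMul (S.zhuMul a b) c = S.zhuMul a (S.zhuMul b c) := by
  obtain ⟨u, rfl⟩ := S.zhuO.mkQ_surjective a
  obtain ⟨v, rfl⟩ := S.zhuO.mkQ_surjective b
  obtain ⟨w, rfl⟩ := S.zhuO.mkQ_surjective c
  exact S.cls_eq_cls.2 (S.star_star_sub_mem_zhuO u v w)

theorem isDifferentialFilteredAlgebra_zhu :
    IsDifferentialFilteredAlgebra S.zhuF S.zhuD S.zhuMul where
  mono _ _ hij := Submodule.map_mono (Submodule.biSup_le_mono S.deg hij)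
  separated := S.zhuF_separated
  exhaustive a := by
    obtain ⟨v, rfl⟩ := S.zhuO.mkQ_surjective a
    obtain ⟨p, hp⟩ := S.deg_isInternal.exists_mem_biSup_le v
    exact ⟨p, Submodule.mem_map_of_mem hp⟩
  d_mem := by
    rintro i _ ⟨v, hv, rfl⟩
    exact Submodule.mem_map_of_mem (S.d_mem_degLE hv)
  d_d_mem := by
    rintro i _ ⟨v, hv, rfl⟩
    rw [zhuD_cls, zhuD_cls, S.d_d, map_zero]
    exact zero_mem _
  assoc := S.zhuMul_assoc
  mul_mem := by
    rintro i j _ _ ⟨u, hu, rfl⟩ ⟨v, hv, rfl⟩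
    exact Submodule.mem_map_of_mem (S.star_mem_degLE hu hv)
  leibniz := by
    rintro p q _ _ ⟨⟨u, hu, rfl⟩, -⟩ ⟨⟨v, hv, rfl⟩, -⟩
    have := Submodule.mem_map_of_mem (f := S.cls) (S.d_star_sub_mem_degLE hu hv)
    rwa [map_sub, map_add, Units.smul_def, map_zsmul] at this

theorem isWeightFiltration_zhu : IsWeightFiltration S.zhuF S.zhuW S.zhuD S.zhuMul where
  mono _ _ hij := Submodule.map_mono (Submodule.biSup_le_mono S.weight hij)
  separated := S.zhuW_separated
  exhaustive a := by
    obtain ⟨v, rfl⟩ := S.zhuO.mkQ_surjective a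
    obtain ⟨k, hk⟩ := S.isInternal_weight.exists_mem_biSup_le v
    exact ⟨k, Submodule.mem_map_of_mem hk⟩
  d_mem := by
    rintro k _ ⟨v, hv, rfl⟩
    exact Submodule.mem_map_of_mem (S.d_mem_weightLE hv)
  mul_mem := by
    rintro j k _ _ ⟨u, hu, rfl⟩ ⟨v, hv, rfl⟩
    exact Submodule.mem_map_of_mem (S.star_mem_weightLE hu hv)
  induced _ := S.isDifferentialFilteredAlgebra_zhu.toIsDifferentialFilteredSpace.restrict _

end DGVertexOperatorAlgebra

end

theorem mainTheorem1 {V : Type*} [AddCommGroup V] [Module ℂ V]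
    (S : DGVertexOperatorAlgebra V) :
    (∀ u x : V, x ∈ S.zhuO → S.star u x ∈ S.zhuO ∧ S.star x u ∈ S.zhuO) ∧
    ∃ (m : S.Zhu →ₗ[ℂ] S.Zhu →ₗ[ℂ] S.Zhu) (dA : S.Zhu →ₗ[ℂ] S.Zhu),
      -- the operations induced by the product and by the differential of `V`
      (∀ u v : V, m (S.cls u) (S.cls v) = S.cls (S.star u v)) ∧
      (∀ v : V, dA (S.cls v) = S.cls (S.d v)) ∧
      -- an associative algebra with unit the class of the vacuum
      (∀ a b c : S.Zhu, m (m a b) c = m a (m b c)) ∧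
      (∀ a : S.Zhu, m (S.cls S.vac) a = a ∧ m a (S.cls S.vac) = a) ∧
      IsDifferentialFilteredAlgebra S.zhuF dA m ∧
      (∀ a : S.Zhu, m (S.cls S.ω) a = m a (S.cls S.ω)) ∧
      IsWeightFiltration S.zhuF S.zhuW dA m := by
  refine ⟨fun u x hx => ⟨S.star_mem_zhuO_left u hx, S.star_mem_zhuO_right hx u⟩, S.zhuMul, S.zhuD,
    S.zhuMul_cls, S.zhuD_cls, S.zhuMul_assoc, fun a => ?_, S.isDifferentialFilteredAlgebra_zhu,
    fun a => ?_, S.isWeightFiltration_zhu⟩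
  · obtain ⟨v, rfl⟩ := S.zhuO.mkQ_surjective a
    exact ⟨congrArg S.cls (S.vac_star v), congrArg S.cls (S.star_vac v)⟩
  · obtain ⟨v, rfl⟩ := S.zhuO.mkQ_surjective a
    exact S.cls_eq_cls.2 (S.star_ω_sub_mem_zhuO v)
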